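/- For a graph $G$ let $f(G)$ be the number of induced cycles of $G$ (cycles of any length at least $3$ that are induced subgraphs of $G$), and let $m(n)$ be the maximum of $f(G)$ over all graphs $G$ on $n$ vertices. A graph $B$ is a cyclic braid if for some $k\ge 3$ there is a partition $B_1,\dots,B_k$ of $V(B)$ into non-empty sets (the clusters) such that, for every $1\le i\le k$ and every $x\in B_i$, $$B_{i-1}\cup B_{i+1}\subseteq N_B(x)\subseteq B_{i-1}\cup B_i\cup B_{i+1},$$ with indices modulo $k$; edges inside the clusters are arbitrary. Theorem. Fix $0<\alpha<1$. There exist constants $C=C(\alpha)$ and $n_0=n_0(\alpha)$ such that the following holds for every $n\ge n_0$. If $F$ is a graph on $n$ vertices with $f(F)\ge\alpha\, m(n)$, then there are a set $S\subseteq V(F)$ with $|S|\le C$ and a graph $F'$ on $V(F)$, obtained from $F$ by adding or deleting only edges with at least one end in $S$, such that $F'$ is a cyclic braid whose clusters all have size $3$, except for exactly one cluster of size $4$ if $n\equiv 1 \pmod 3$ and exactly one cluster of size $2$ if $n\equiv 2\pmod 3$ (these are the cluster sizes of the graph $H_n$, the empty cyclic braid on $n$ vertices with this description). -/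

import Mathlib

/-- `S` is the vertex set of an induced cycle of `G`: the subgraph of `G` induced on `S` is a
cycle with `k ≥ 3` vertices (triangles count). An induced cycle is determined by its vertex set. -/
def IsInducedCycle {V : Type*} (G : SimpleGraph V) (S : Finset V) : Prop :=
  ∃ k : ℕ, 3 ≤ k ∧ Nonempty (SimpleGraph.cycleGraph k ≃g G.induce (S : Set V))

/-- The number of induced cycles (of all lengths) of `G`. -/
noncomputable def numInducedCycles {V : Type*} (G : SimpleGraph V) : ℕ :=
  {S : Finset V | IsInducedCycle G S}.ncard

/-- `m(n)`: the maximum number of induced cycles in a graph on `n` vertices. The supremum is over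
a finite nonempty set, so it is attained. -/
noncomputable def maxInducedCycles (n : ℕ) : ℕ :=
  sSup (Set.range fun G : SimpleGraph (Fin n) => numInducedCycles G)

/-- `G` is a cyclic braid of length `k` with clusters `B 0, …, B (k - 1)`. The cyclic successor
`i + 1` modulo `k` of an index `i` is `finRotate k i`, and `i - 1` is `(finRotate k).symm i`.
Edges inside a cluster are unrestricted. -/
structure IsCyclicBraid {V : Type*} (G : SimpleGraph V) {k : ℕ} (B : Fin k → Finset V) :
    Prop where
  three_le : 3 ≤ k
  nonempty : ∀ i, (B i).Nonempty
  partition : ∀ v, ∃! i, v ∈ B i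
  subset_neighborSet : ∀ i, ∀ x ∈ B i,
    (B ((finRotate k).symm i) ∪ B (finRotate k i) : Set V) ⊆ G.neighborSet x
  neighborSet_subset : ∀ i, ∀ x ∈ B i,
    G.neighborSet x ⊆ (B ((finRotate k).symm i) ∪ B i ∪ B (finRotate k i) : Set V)

/-- The multiset of cluster sizes of a family of clusters. -/
def clusterSizes {V : Type*} {k : ℕ} (B : Fin k → Finset V) : Multiset ℕ :=
  Finset.univ.val.map fun i => (B i).card

/-- The cluster sizes of the extremal graph `H_n` (`n ≥ 8`), an empty cyclic braid on `n` vertices: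
all clusters have size `3`, except for one of size `4` if `n ≡ 1 (mod 3)` and one of size `2`
if `n ≡ 2 (mod 3)`. -/
def extremalClusterSizes (n : ℕ) : Multiset ℕ :=
  if n % 3 = 0 then Multiset.replicate (n / 3) 3
  else if n % 3 = 1 then 4 ::ₘ Multiset.replicate (n / 3 - 1) 3
  else 2 ::ₘ Multiset.replicate (n / 3) 3

/-! Write c for the cube root of 3. An induced path that starts in x and runs through W chooses, at
each step, one of the d neighbours of its current end among the vertices not yet seen, and all d of
them are then used up. Since d ≤ c ^ d, with equality only for d = 3, at most c ^ |W| induced paths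
lead to a fixed end w. The inequality survives an extra factor 1.03 for each unit of |d - 3|, so the
total deviation from "three new vertices per step" has bounded average relative to c ^ |W|
(`sum_defect_weight_le`). An induced cycle without its largest vertex is an induced path, and m(n)
is of order c ^ n. Hence a graph with at least α m(n) induced cycles has some x, w, W with at least
ρ c ^ n such paths, where ρ depends only on α (`exists_many_indPaths`), and W misses boundedly many
vertices.

The structure comes from an increment argument on `ratio`, the number of paths divided by c ^ |W|.
It never exceeds 1, so it can grow by a factor 1 + δ only boundedly often. When no bounded deletion
and no new starting vertex makes it grow (`PathIrreducible`), the tree of paths is ternary to a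
large depth, its branches are almost equally rich, and every unseen vertex lies on at least 30% of
the continuations (`PathIrreducible.ternaryTree`).

The heart is `exists_homogeneousAt`: in such a tree the three neighbours of x have the same
neighbours further on. Otherwise one of any two consecutive vertices on a path has disagreeing
children, and each disagreement yields, on 30% of the continuations, an outside vertex v that sees
the path at two distant places, a chord. So the number of chords grows linearly with the depth, at a
fixed rate per step. Chords that jump over a given place are bounded on average, since the first
part of the path and the rest together see only about |W| vertices, with small overlap. A short
chord can be used as a shortcut through v; the shortened path sees too few vertices, and this
produces a chord over a place far ahead. Thus short chords are bounded too, and the linear growth is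
impossible.

The neighbours of x therefore form a cluster of size three that can be peeled off without lowering
the ratio; iteration, with boundedly many interruptions, gives a chain of clusters
(`exists_isClusterChain`). The exceptional vertices are regrouped into clusters of the right sizes
and inserted between the two ends of the chain. All edges that this affects meet the exceptional
set. -/

set_option linter.unusedSectionVars false

/-! ### Induced paths and their tree structure -/

section InducedPaths

variable {V : Type*}

/-- The list `l` is, in this order, the vertex sequence of an induced path of `G`. -/
def IsInd (G : SimpleGraph V) : List V → Prop
  | [] => True
  | a :: l => a ∉ l ∧ (∀ c ∈ l, G.Adj a c ↔ l.head? = some c) ∧ IsInd G l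

theorem isInd_append {G : SimpleGraph V} {l₁ l₂ : List V} :
    IsInd G (l₁ ++ l₂) ↔ IsInd G l₁ ∧ IsInd G l₂ ∧
      ∀ a ∈ l₁, ∀ b ∈ l₂, a ≠ b ∧ (G.Adj a b ↔ l₁.getLast? = some a ∧ l₂.head? = some b) := by
  induction l₁ with
  | nil => simp [IsInd]
  | cons a l ih =>
    rw [List.cons_append, IsInd, IsInd, ih]
    rcases l with _ | ⟨b, l⟩
    · simp only [List.nil_append, List.not_mem_nil, not_false_eq_true, List.head?_nil, IsInd]
      constructor
      · rintro ⟨h1, h2, -, h3, -⟩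
        refine ⟨by simp, h3, ?_⟩
        intro a' ha' c hc
        obtain rfl : a' = a := by simpa using ha'
        exact ⟨fun h => h1 (h ▸ hc), by simpa using h2 c hc⟩
      · rintro ⟨-, h3, h4⟩
        refine ⟨fun h => (h4 a (by simp) a h).1 rfl, fun c hc => ?_, trivial, h3, by simp⟩
        simpa using (h4 a (by simp) c hc).2
    · constructor
      · rintro ⟨h1, h2, h3, h4, h5⟩
        refine ⟨⟨fun h => h1 (by simp at h ⊢; tauto), fun c hc => ?_, h3⟩, h4, ?_⟩
        · simpa using h2 c (List.mem_append_left _ hc)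
        · intro a' ha' c hc
          rcases List.mem_cons.1 ha' with rfl | ha'
          · refine ⟨fun h => h1 (h ▸ List.mem_append_right _ hc), ?_⟩
            have e1 := h2 c (List.mem_append_right _ hc)
            have e2 : (b :: l).getLast? ≠ some a' := fun h =>
              h1 (List.mem_append_left _ (List.mem_of_getLast? h))
            have e3 : b ≠ c := (h5 b (by simp) c hc).1
            simp only [List.cons_append, List.head?_cons, Option.some.injEq] at e1
            rw [List.getLast?_cons_cons]
            tauto
          · rw [List.getLast?_cons_cons]
            exact h5 a' ha' c hc
      · rintro ⟨⟨h1, h2, h3⟩, h4, h5⟩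
        refine ⟨?_, ?_, h3, h4, ?_⟩
        · intro h
          rcases List.mem_append.1 h with h | h
          · exact h1 h
          · exact (h5 a (by simp) a h).1 rfl
        · intro c hc
          rcases List.mem_append.1 hc with h | h
          · simpa using h2 c h
          · have e1 := (h5 a (by simp) c h).2
            have e2 : (b :: l).getLast? ≠ some a := fun h => h1 (List.mem_of_getLast? h)
            have e3 : b ≠ c := (h5 b (by simp) c h).1
            rw [List.getLast?_cons_cons] at e1
            simp only [List.cons_append, List.head?_cons, Option.some.injEq]
            tauto
        · intro a' ha' c hc
          have := h5 a' (List.mem_cons_of_mem _ ha') c hc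
          rwa [List.getLast?_cons_cons] at this

theorem IsInd.nodup {G : SimpleGraph V} {l : List V} (h : IsInd G l) : l.Nodup := by
  induction l with
  | nil => simp
  | cons a l ih => exact List.nodup_cons.2 ⟨h.1, ih h.2.2⟩

theorem IsInd.reverse {G : SimpleGraph V} {l : List V} (h : IsInd G l) : IsInd G l.reverse := by
  induction l with
  | nil => simpa
  | cons a l ih =>
    rw [List.reverse_cons, isInd_append]
    refine ⟨ih h.2.2, ⟨by simp, by simp, trivial⟩, ?_⟩
    intro c hc b hb
    obtain rfl : b = a := by simpa using hb
    have hc' : c ∈ l := by simpa using hc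
    refine ⟨fun e => h.1 (e ▸ hc'), ?_⟩
    rw [G.adj_comm, h.2.1 c hc']
    simp

theorem isInd_of_getElem {G : SimpleGraph V} {l : List V} (hl : l.Nodup)
    (h : ∀ i j (hj : j < l.length) (hij : i < j), G.Adj (l[i]'(hij.trans hj)) l[j] ↔ j = i + 1) :
    IsInd G l := by
  induction l with
  | nil => trivial
  | cons a l ih =>
    rw [List.nodup_cons] at hl
    refine ⟨hl.1, ?_, ih hl.2 ?_⟩
    · intro c hc
      obtain ⟨j, hj, rfl⟩ := List.getElem_of_mem hc
      have := h 0 (j + 1) (by simpa using hj) (by omega)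
      simp only [List.getElem_cons_zero, List.getElem_cons_succ] at this
      rw [this, List.head?_eq_getElem?, List.getElem?_eq_getElem (by omega)]
      simp only [Option.some.injEq, hl.2.getElem_inj_iff]
      omega
    · intro i j hj hij
      have := h (i + 1) (j + 1) (by simpa using hj) (by omega)
      simpa using this

/-- `B` is an induced path that starts in `x` and then stays in `W`. -/
def IsPre (G : SimpleGraph V) (W : Finset V) (x : V) (B : List V) : Prop :=
  IsInd G B ∧ B.head? = some x ∧ ∀ c ∈ B.tail, c ∈ W

variable [DecidableEq V] (G : SimpleGraph V) [DecidableRel G.Adj]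

/-- The neighbours of `x` in `W`. -/
def nb (W : Finset V) (x : V) : Finset V := W.filter fun u => G.Adj x u

/-- The vertices of `W` with no neighbour in the list `A`. -/
def rem (W : Finset V) (A : List V) : Finset V := W.filter fun u => ∀ b ∈ A, ¬ G.Adj b u

variable {G}

theorem mem_nb {W : Finset V} {x u : V} : u ∈ nb G W x ↔ u ∈ W ∧ G.Adj x u := by simp [nb]

theorem mem_rem {W : Finset V} {A : List V} {u : V} :
    u ∈ rem G W A ↔ u ∈ W ∧ ∀ b ∈ A, ¬ G.Adj b u := by simp [rem]

theorem mem_rem_singleton {W : Finset V} {x u : V} :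
    u ∈ rem G W [x] ↔ u ∈ W ∧ ¬ G.Adj x u := by simp [rem]

theorem rem_subset {W : Finset V} {A : List V} : rem G W A ⊆ W := Finset.filter_subset _ _

@[simp] theorem rem_nil {W : Finset V} : rem G W [] = W := by simp [rem]

theorem rem_append {W : Finset V} {A B : List V} :
    rem G W (A ++ B) = rem G (rem G W A) B := by
  ext u; simp only [mem_rem, List.mem_append]; constructor
  · rintro ⟨h, h'⟩; exact ⟨⟨h, fun b hb => h' b (.inl hb)⟩, fun b hb => h' b (.inr hb)⟩
  · rintro ⟨⟨h, h1⟩, h2⟩; exact ⟨h, fun b hb => hb.elim (h1 b) (h2 b)⟩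

theorem rem_cons {W : Finset V} {a : V} {B : List V} :
    rem G W (a :: B) = rem G (rem G W [a]) B := rem_append (A := [a])

theorem sdiff_nb {W : Finset V} {x : V} : W \ nb G W x = rem G W [x] := by
  ext u; simp only [Finset.mem_sdiff, mem_nb, mem_rem_singleton]; tauto

theorem card_rem_add {W : Finset V} {x : V} :
    (rem G W [x]).card + (nb G W x).card = W.card := by
  rw [← sdiff_nb]
  exact Finset.card_sdiff_add_card_eq_card (Finset.filter_subset _ _)

theorem isPre_singleton {W : Finset V} {x : V} : IsPre G W x [x] :=
  ⟨⟨by simp, by simp, trivial⟩, by simp, by simp⟩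

theorem IsPre.of_append {W : Finset V} {x : V} {A B : List V} (hA : A ≠ [])
    (h : IsPre G W x (A ++ B)) : IsPre G W x A := by
  obtain ⟨h1, h2, h3⟩ := h
  rcases A with _ | ⟨a, A⟩
  · exact absurd rfl hA
  · exact ⟨(isInd_append.1 h1).1, by simpa using h2, fun c hc => h3 c (by
      simp at hc ⊢; exact .inl hc)⟩

/-- Every vertex of such a path has an earlier neighbour or is the first one. -/
theorem IsPre.notMem_rem {W : Finset V} {x : V} (hx : x ∉ W) {A : List V} {a : V}
    (h : IsPre G W x (A ++ [a])) : ∀ c ∈ A ++ [a], c ∉ rem G W A := by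
  induction A using List.reverseRecOn generalizing a with
  | nil =>
    obtain ⟨-, h2, -⟩ := h
    simp at h2 ⊢; subst h2; exact hx
  | append_singleton A b ih =>
    intro c hc
    rw [List.mem_append] at hc
    rw [rem_append]
    rcases hc with hc | hc
    · exact fun h' => ih (h.of_append (by simp)) c hc (rem_subset h')
    · obtain rfl : c = a := by simpa using hc
      intro h'
      have := ((isInd_append.1 h.1).2.2 b (by simp) c (by simp)).2.2 (by simp)
      exact (mem_rem_singleton.1 h').2 this

/-- Inducedness forbids later vertices from being adjacent to `A`, and nothing else about `A`
matters. So the paths below a prefix are again all paths of a smaller instance, which makes every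
statement about (`W`, `x`) available at each node of the tree. -/
theorem IsPre.append {W : Finset V} {x : V} (hx : x ∉ W) {A T : List V} {a : V}
    (h : IsPre G W x (A ++ [a])) :
    IsPre G W x (A ++ a :: T) ↔ IsPre G (rem G W A) a (a :: T) := by
  have hnot := h.notMem_rem hx
  constructor
  · rintro ⟨h1, h2, h3⟩
    have h4 := isInd_append.1 h1
    refine ⟨h4.2.1, rfl, fun c hc => mem_rem.2 ⟨h3 c ?_, fun b hb hadj => ?_⟩⟩
    · rcases A with _ | ⟨a', A⟩
      · simpa using hc
      · simp at hc ⊢; tauto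
    · have h5 := (h4.2.2 b hb c (by simp at hc ⊢; tauto)).2.1 hadj
      have h6 : a = c := by simpa using h5.2
      subst h6
      exact h4.2.1.1 (by simpa using hc)
  · rintro ⟨h1, -, h3⟩
    refine ⟨isInd_append.2 ⟨(isInd_append.1 h.1).1, h1, ?_⟩, ?_, ?_⟩
    · intro b hb c hc
      rcases List.mem_cons.1 hc with rfl | hc
      · have := (isInd_append.1 h.1).2.2 b hb c (by simp)
        simpa using this
      · have hc' := h3 c hc
        refine ⟨fun e => hnot b (by simp [hb]) (e ▸ hc'), ?_⟩
        have h5 := (mem_rem.1 hc').2 b hb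
        have h6 : a ≠ c := fun e => h1.1 (e ▸ hc)
        simp [h5, h6]
    · have := h.2.1
      rcases A with _ | ⟨a', A⟩ <;> simpa using this
    · intro c hc
      rcases A with _ | ⟨a', A⟩
      · exact rem_subset (h3 c (by simpa using hc))
      · have h7 := h.2.2
        simp only [List.cons_append, List.tail_cons, List.mem_append, List.mem_cons,
          List.not_mem_nil, or_false] at h7 hc
        rcases hc with hc | hc | hc
        · exact h7 c (.inl hc)
        · exact h7 c (.inr hc)
        · exact rem_subset (h3 c hc)

variable [Fintype V] (G)

/-- The induced paths of `G` from `x` to `w` that stay in `W` after their first vertex. -/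
noncomputable def indPaths (w : V) (W : Finset V) (x : V) : Finset (List V) :=
  Set.Finite.toFinset (s := {l | IsPre G W x l ∧ l.getLast? = some w}) <| by
    refine Set.Finite.subset (Set.finite_range (Subtype.val : {l : List V // l.Nodup} → List V)) ?_
    rintro l ⟨h, -⟩
    exact ⟨⟨l, h.1.nodup⟩, rfl⟩

variable {G} {w x : V} {W : Finset V}

theorem mem_indPaths {l : List V} :
    l ∈ indPaths G w W x ↔ IsPre G W x l ∧ l.getLast? = some w := by simp [indPaths]

theorem append_mem_indPaths (hx : x ∉ W) {A T : List V} {a : V} (h : IsPre G W x (A ++ [a])) :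
    A ++ a :: T ∈ indPaths G w W x ↔ a :: T ∈ indPaths G w (rem G W A) a := by
  rw [mem_indPaths, mem_indPaths, h.append hx]
  simp [List.getLast?_append]

theorem indPaths_self (hx : w ∉ W) : indPaths G w W w = {[w]} := by
  ext l
  rw [mem_indPaths, Finset.mem_singleton]
  constructor
  · rintro ⟨⟨h1, h2, h3⟩, h4⟩
    rcases l with _ | ⟨a, _ | ⟨b, l⟩⟩
    · simp at h2
    · simpa using h2
    · rw [List.getLast?_cons_cons] at h4
      exact absurd (h3 w (by simpa using List.mem_of_getLast? h4)) hx
  · rintro rfl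
    exact ⟨isPre_singleton, rfl⟩

theorem indPaths_eq_empty (hxw : x ≠ w) (hw : w ∉ W) : indPaths G w W x = ∅ := by
  rw [Finset.eq_empty_iff_forall_notMem]
  intro l hl
  obtain ⟨⟨h1, h2, h3⟩, h4⟩ := mem_indPaths.1 hl
  rcases l with _ | ⟨a, _ | ⟨b, l⟩⟩
  · simp at h2
  · simp at h2 h4; exact hxw (h2 ▸ h4)
  · rw [List.getLast?_cons_cons] at h4
    exact hw (h3 w (by simpa using List.mem_of_getLast? h4))

theorem isPre_pair {v : V} (hv : v ∈ nb G W x) : IsPre G W x ([x] ++ [v]) := by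
  obtain ⟨h1, h2⟩ := mem_nb.1 hv
  refine ⟨⟨by simpa using h2.ne, by simpa using h2, by simp [IsInd]⟩, rfl, by simpa using h1⟩

theorem indPaths_eq_biUnion (hx : x ∉ W) (hxw : x ≠ w) :
    indPaths G w W x =
      (nb G W x).biUnion fun v => (indPaths G w (rem G W [x]) v).image (List.cons x) := by
  ext l
  rw [Finset.mem_biUnion]
  constructor
  · intro hl
    obtain ⟨⟨h1, h2, h3⟩, h4⟩ := mem_indPaths.1 hl
    rcases l with _ | ⟨a, _ | ⟨b, l⟩⟩
    · simp at h2
    · simp at h2 h4; exact absurd (h2 ▸ h4) hxw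
    · obtain rfl : a = x := by simpa using h2
      have hb : b ∈ nb G W a := mem_nb.2 ⟨h3 b (by simp), (h1.2.1 b (by simp)).2 rfl⟩
      refine ⟨b, hb, Finset.mem_image.2 ⟨b :: l, ?_, rfl⟩⟩
      exact (append_mem_indPaths (A := [a]) hx (isPre_pair hb)).1 hl
  · rintro ⟨v, hv, hl⟩
    obtain ⟨t, ht, rfl⟩ := Finset.mem_image.1 hl
    have h2 := (mem_indPaths.1 ht).1.2.1
    rcases t with _ | ⟨b, t⟩
    · simp at h2
    · obtain rfl : b = v := by simpa using h2
      exact (append_mem_indPaths (A := [x]) hx (isPre_pair hv)).2 ht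

theorem sum_indPaths {M : Type*} [AddCommMonoid M] (hx : x ∉ W) (hxw : x ≠ w) (f : List V → M) :
    ∑ l ∈ indPaths G w W x, f l =
      ∑ v ∈ nb G W x, ∑ l ∈ indPaths G w (rem G W [x]) v, f (x :: l) := by
  rw [indPaths_eq_biUnion hx hxw, Finset.sum_biUnion]
  · refine Finset.sum_congr rfl fun v _ => ?_
    rw [Finset.sum_image (by intro a _ b _ h; simpa using h)]
  · intro v _ v' _ hne
    rw [Function.onFun, Finset.disjoint_left]
    rintro l h1 h2
    obtain ⟨t, ht, rfl⟩ := Finset.mem_image.1 h1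
    obtain ⟨t', ht', e⟩ := Finset.mem_image.1 h2
    obtain rfl : t' = t := by simpa using e
    have e1 := (mem_indPaths.1 ht).1.2.1
    have e2 := (mem_indPaths.1 ht').1.2.1
    rw [e1] at e2
    exact hne (by simpa using e2)

theorem card_indPaths (hx : x ∉ W) (hxw : x ≠ w) :
    (indPaths G w W x).card = ∑ v ∈ nb G W x, (indPaths G w (rem G W [x]) v).card := by
  simp only [Finset.card_eq_sum_ones]
  exact sum_indPaths hx hxw fun _ => 1

theorem notMem_rem_of_mem_nb {v : V} (hv : v ∈ nb G W x) : v ∉ rem G W [x] := fun h =>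
  (mem_rem_singleton.1 h).2 (mem_nb.1 hv).2

/-- The paths with a given initial segment. -/
theorem card_filter_prefix (hx : x ∉ W) {A : List V} {a : V} (h : IsPre G W x (A ++ [a])) :
    ((indPaths G w W x).filter fun l => A ++ [a] <+: l).card =
      (indPaths G w (rem G W A) a).card := by
  symm
  refine Finset.card_bij (fun T _ => A ++ T) ?_ ?_ ?_
  · intro T hT
    have h2 := (mem_indPaths.1 hT).1.2.1
    rcases T with _ | ⟨b, T⟩
    · simp at h2
    · obtain rfl : b = a := by simpa using h2
      exact Finset.mem_filter.2 ⟨(append_mem_indPaths hx h).2 hT, ⟨T, by simp⟩⟩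
  · intro T _ T' _ e; simpa using e
  · intro l hl
    obtain ⟨hl, T, rfl⟩ := Finset.mem_filter.1 hl
    refine ⟨a :: T, ?_, by simp⟩
    rw [List.append_assoc, List.singleton_append] at hl
    exact (append_mem_indPaths hx h).1 hl

/-- Reversal lets the defect estimate be applied from the far end of a path. The new vertex set has
the same size as `W`. -/
theorem reverse_mem_indPaths (hxw : x ≠ w) {l : List V} (hl : l ∈ indPaths G w W x) :
    l.reverse ∈ indPaths G x (insert x (W.erase w)) w := by
  obtain ⟨⟨h1, h2, h3⟩, h4⟩ := mem_indPaths.1 hl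
  refine mem_indPaths.2 ⟨⟨h1.reverse, by simpa using h4, ?_⟩, by simpa using h2⟩
  intro c hc
  rw [List.tail_reverse, List.mem_reverse] at hc
  rw [Finset.mem_insert, Finset.mem_erase]
  by_cases hcx : c = x
  · exact .inl hcx
  · refine .inr ⟨?_, h3 c ?_⟩
    · rintro rfl
      have hne : l ≠ [] := by rintro rfl; simp at h2
      have h5 := List.dropLast_append_getLast hne
      have h6 : l.getLast hne = c := by
        rw [List.getLast?_eq_getLast_of_ne_nil hne] at h4; simpa using h4
      have h7 := h1.nodup
      rw [← h5, h6, List.nodup_append] at h7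
      exact h7.2.2 c hc c (by simp) rfl
    · have := List.mem_of_mem_dropLast hc
      rcases l with _ | ⟨a, l⟩
      · simp at this
      · obtain rfl : a = x := by simpa using h2
        simpa [hcx] using this

end InducedPaths

/-! ### The numerical inequality behind the count -/

/-- The cube root of three. -/
noncomputable def cbrt3 : ℝ := (3 : ℝ) ^ ((1 : ℝ) / 3)

theorem cbrt3_pow_three : cbrt3 ^ 3 = 3 := by
  rw [cbrt3, ← Real.rpow_natCast, ← Real.rpow_mul (by norm_num)]; norm_num

theorem cbrt3_pos : 0 < cbrt3 := Real.rpow_pos_of_pos (by norm_num) _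

theorem le_cbrt3 {a : ℝ} (h : a ^ 3 ≤ 3) : a ≤ cbrt3 :=
  le_of_pow_le_pow_left₀ (n := 3) (by norm_num) cbrt3_pos.le (by rwa [cbrt3_pow_three])

theorem one_lt_cbrt3 : 1 < cbrt3 := lt_of_lt_of_le (by norm_num) (le_cbrt3 (a := 1.44) (by norm_num))

/-- The maximum of d / 3 ^ (d / 3) over the integers is attained only at d = 3. The tight case for
the margin 1.03 is d = 2, where 2.06 is compared with 1.44 ^ 2 = 2.0736. -/
theorem mul_pow_le_cbrt3_pow (d : ℕ) :
    (d : ℝ) * (1.03 : ℝ) ^ ((d - 3) + (3 - d)) ≤ cbrt3 ^ d := by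
  have h0 := cbrt3_pos
  have h144 : (1.44 : ℝ) ≤ cbrt3 := le_cbrt3 (by norm_num)
  rcases lt_or_ge d 3 with h | h
  · interval_cases d
    · norm_num
    · refine le_trans ?_ (h144.trans (by norm_num)); norm_num
    · refine le_trans ?_ (pow_le_pow_left₀ (by norm_num) h144 2); norm_num
  · induction d, h using Nat.le_induction with
    | base => rw [cbrt3_pow_three]; norm_num
    | succ d hd ih =>
      have e1 : (d - 3) + (3 - d) = d - 3 := by omega
      have e2 : (d + 1 - 3) + (3 - (d + 1)) = (d - 3) + 1 := by omega
      rw [e1] at ih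
      rw [e2, pow_succ, pow_succ]
      have hd' : (3 : ℝ) ≤ d := by exact_mod_cast hd
      have hp : (0 : ℝ) < 1.03 ^ (d - 3) := by positivity
      calc ((d + 1 : ℕ) : ℝ) * (1.03 ^ (d - 3) * 1.03)
          = (((d : ℝ) + 1) * 1.03) * 1.03 ^ (d - 3) := by push_cast; ring
        _ ≤ (d * 1.44) * 1.03 ^ (d - 3) :=
            mul_le_mul_of_nonneg_right (by linarith) hp.le
        _ = (d * 1.03 ^ (d - 3)) * 1.44 := by ring
        _ ≤ cbrt3 ^ d * cbrt3 := mul_le_mul ih h144 (by norm_num) (by positivity)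

/-! ### Exponential bound for the defect, and vertices seen from both parts of a path -/

section Weights

variable {V : Type*} [DecidableEq V] (G : SimpleGraph V) [DecidableRel G.Adj]

/-- How far a path is from seeing three new vertices of `W` in every step and leaving no vertex
of `W` unseen. -/
def defect : Finset V → List V → ℕ
  | _, [] => 0
  | W, [_] => W.card
  | W, a :: b :: l =>
      (((nb G W a).card - 3) + (3 - (nb G W a).card)) + defect (rem G W [a]) (b :: l)

/-- The number of vertices of `W` with neighbours both among the first `k` and among the other
vertices of the path `l`. -/
def straddle (W : Finset V) (k : ℕ) (l : List V) : ℕ :=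
  (W.filter fun z => (∃ b ∈ l.take k, G.Adj b z) ∧ ∃ b ∈ l.drop k, G.Adj b z).card

variable {G}

theorem card_sdiff_rem_take_le (W : Finset V) (k : ℕ) (l : List V) :
    (W \ rem G W (l.take k)).card ≤ 3 * k + defect G W l := by
  induction k generalizing W l with
  | zero => simp
  | succ k ih =>
    rcases l with _ | ⟨a, _ | ⟨b, l⟩⟩
    · simp
    · exact (Finset.card_le_card Finset.sdiff_subset).trans (by rw [defect]; omega)
    · rw [List.take_succ_cons, rem_cons, defect]
      have h1 := ih (rem G W [a]) (b :: l)
      have h2 : W \ rem G (rem G W [a]) ((b :: l).take k) ⊆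
          nb G W a ∪ (rem G W [a] \ rem G (rem G W [a]) ((b :: l).take k)) := by
        intro z hz
        simp only [Finset.mem_union, Finset.mem_sdiff, mem_nb, mem_rem, List.mem_singleton,
          forall_eq] at hz ⊢
        tauto
      have h3 := (Finset.card_le_card h2).trans (Finset.card_union_le _ _)
      omega

theorem three_mul_length_le (W : Finset V) {l : List V} (hl : l ≠ []) :
    3 * l.length ≤ W.card + defect G W l + 3 := by
  induction l generalizing W with
  | nil => exact absurd rfl hl
  | cons a l ih =>
    rcases l with _ | ⟨b, l⟩
    · simp
    · have h1 := ih (rem G W [a]) (by simp)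
      have h2 := card_rem_add (G := G) (W := W) (x := a)
      rw [defect, List.length_cons]
      omega

theorem card_rem_le_defect (W : Finset V) {l : List V} (hl : l ≠ []) :
    (rem G W l).card ≤ defect G W l := by
  induction l generalizing W with
  | nil => exact absurd rfl hl
  | cons a l ih =>
    rcases l with _ | ⟨b, l⟩
    · exact Finset.card_le_card rem_subset
    · rw [rem_cons, defect]
      exact (ih _ (by simp)).trans (by omega)

variable [Fintype V] {w x : V} {W : Finset V}

/-- Inclusion and exclusion: the first `k` vertices see about 3k vertices, the others, read
backwards, about three each, while the whole path sees almost all of `W`, which has about three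
vertices per path vertex. All errors are defects, so the overlap is small. -/
theorem straddle_le (hx : x ∉ W) (hxw : x ≠ w) {l : List V} (hl : l ∈ indPaths G w W x) (k : ℕ) :
    straddle G W k l ≤
      3 * defect G W l + defect G (insert x (W.erase w)) l.reverse + 4 := by
  have hne : l ≠ [] := by
    rintro rfl; simpa using (mem_indPaths.1 hl).1.2.1
  have hw : w ∈ W := by
    by_contra hw
    rw [indPaths_eq_empty hxw hw] at hl; simp at hl
  rcases le_or_gt l.length k with hk | hk
  · simp [straddle, List.drop_eq_nil_of_le hk]
  set W' := insert x (W.erase w) with hW'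
  have hcard : W'.card = W.card := by
    rw [hW', Finset.card_insert_of_notMem (by simp [hx]), Finset.card_erase_of_mem hw]
    have := Finset.card_pos.2 ⟨w, hw⟩
    omega
  set T₁ := W \ rem G W (l.take k) with hT₁
  set T₂ := W.filter fun z => ∃ b ∈ l.drop k, G.Adj b z with hT₂
  have h1 : straddle G W k l ≤ (T₁ ∩ T₂).card := by
    refine Finset.card_le_card fun z hz => ?_
    obtain ⟨hz1, ⟨b, hb, hbz⟩, h3⟩ := Finset.mem_filter.1 hz
    refine Finset.mem_inter.2 ⟨Finset.mem_sdiff.2 ⟨hz1, fun h => (mem_rem.1 h).2 b hb hbz⟩,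
      Finset.mem_filter.2 ⟨hz1, h3⟩⟩
  have h2 : T₁.card ≤ 3 * k + defect G W l := card_sdiff_rem_take_le W k l
  have h3 : T₂.card ≤ 3 * (l.length - k) + defect G W' l.reverse + 1 := by
    have h4 := card_sdiff_rem_take_le (G := G) W' (l.length - k) l.reverse
    have h5 : T₂ ⊆ insert w (W' \ rem G W' (l.reverse.take (l.length - k))) := by
      intro z hz
      obtain ⟨hz1, b, hb, hbz⟩ := Finset.mem_filter.1 hz
      by_cases hzw : z = w
      · simp [hzw]
      · refine Finset.mem_insert_of_mem (Finset.mem_sdiff.2 ⟨?_, fun h => ?_⟩)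
        · simp [hW', hz1, hzw]
        · refine (mem_rem.1 h).2 b ?_ hbz
          rw [List.take_reverse, List.mem_reverse]
          convert hb using 2
          omega
    exact (Finset.card_le_card h5).trans ((Finset.card_insert_le _ _).trans (by omega))
  have h6 : W.card ≤ (T₁ ∪ T₂).card + defect G W l := by
    have h7 : W ⊆ (T₁ ∪ T₂) ∪ rem G W l := by
      intro z hz
      by_cases h : z ∈ rem G W l
      · exact Finset.mem_union_right _ h
      · refine Finset.mem_union_left _ ?_
        have h8 : ∃ b ∈ l, G.Adj b z := by
          by_contra hcon; push Not at hcon; exact h (mem_rem.2 ⟨hz, hcon⟩)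
        obtain ⟨b, hb, hbz⟩ := h8
        rw [← List.take_append_drop k l, List.mem_append] at hb
        rcases hb with hb | hb
        · exact Finset.mem_union_left _ (Finset.mem_sdiff.2 ⟨hz, fun h => (mem_rem.1 h).2 b hb hbz⟩)
        · exact Finset.mem_union_right _ (Finset.mem_filter.2 ⟨hz, b, hb, hbz⟩)
    have := (Finset.card_le_card h7).trans (Finset.card_union_le _ _)
    have := card_rem_le_defect (G := G) W hne
    omega
  have h7 := Finset.card_union_add_card_inter T₁ T₂
  have h8 := three_mul_length_le (G := G) W hne
  omega

/-- Induction on |W|: a first step with d choices multiplies the sum by at most d * 1.03 ^ |d - 3| ≤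
c ^ d and removes d vertices. -/
theorem sum_defect_weight_le (hx : x ∉ W) :
    ∑ l ∈ indPaths G w W x, (1.03 : ℝ) ^ defect G W l ≤ cbrt3 ^ W.card := by
  induction hn : W.card using Nat.strong_induction_on generalizing W x with
  | _ n ih =>
  by_cases hxw : x = w
  · subst hxw
    rw [indPaths_self hx, Finset.sum_singleton, defect, hn]
    exact pow_le_pow_left₀ (by norm_num) (le_cbrt3 (by norm_num)) _
  · rw [sum_indPaths hx hxw]
    have hc := card_rem_add (G := G) (W := W) (x := x)
    set d := (nb G W x).card with hd
    have key : ∀ v ∈ nb G W x, ∑ l ∈ indPaths G w (rem G W [x]) v,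
        (1.03 : ℝ) ^ defect G W (x :: l) ≤
          (1.03 : ℝ) ^ ((d - 3) + (3 - d)) * cbrt3 ^ (n - d) := by
      intro v hv
      have hd0 : 0 < d := Finset.card_pos.2 ⟨v, hv⟩
      have h1 := ih (n - d) (by omega) (notMem_rem_of_mem_nb hv) (by omega)
      refine le_trans (le_of_eq ?_) (mul_le_mul_of_nonneg_left h1 (by positivity))
      rw [Finset.mul_sum]
      refine Finset.sum_congr rfl fun l hl => ?_
      have h2 := (mem_indPaths.1 hl).1.2.1
      rcases l with _ | ⟨b, l⟩
      · simp at h2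
      · rw [defect, pow_add]
    refine (Finset.sum_le_card_nsmul _ _ _ key).trans ?_
    rw [nsmul_eq_mul, ← mul_assoc]
    refine (mul_le_mul_of_nonneg_right (mul_pow_le_cbrt3_pow d) (pow_nonneg cbrt3_pos.le _)).trans ?_
    rw [← pow_add, Nat.add_sub_cancel' (by omega)]

theorem card_indPaths_le (hx : x ∉ W) : ((indPaths G w W x).card : ℝ) ≤ cbrt3 ^ W.card := by
  refine le_trans ?_ (sum_defect_weight_le (G := G) (w := w) hx)
  rw [Finset.card_eq_sum_ones]
  push_cast
  exact Finset.sum_le_sum fun l _ => one_le_pow₀ (by norm_num)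

theorem sum_defect_le (hx : x ∉ W) :
    ∑ l ∈ indPaths G w W x, (defect G W l : ℝ) ≤ 100 / 3 * cbrt3 ^ W.card := by
  refine le_trans ?_ (mul_le_mul_of_nonneg_left (sum_defect_weight_le (G := G) (w := w) hx)
    (by norm_num))
  rw [Finset.mul_sum]
  refine Finset.sum_le_sum fun l _ => ?_
  have := one_add_mul_le_pow (a := (0.03 : ℝ)) (by norm_num) (defect G W l)
  have e : (1 + 0.03 : ℝ) = 1.03 := by norm_num
  rw [e] at this
  linarith

/-- Averages `straddle_le`: each defect sum contributes at most 100/3, so the constant is 3 * 100/3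
+ 100/3 + 4 < 138, independently of `k`. -/
theorem sum_straddle_le (hx : x ∉ W) (hxw : x ≠ w) (k : ℕ) :
    ∑ l ∈ indPaths G w W x, (straddle G W k l : ℝ) ≤ 138 * cbrt3 ^ W.card := by
  by_cases hw : w ∈ W
  swap
  · rw [indPaths_eq_empty hxw hw]
    simpa using pow_nonneg cbrt3_pos.le _
  set W' := insert x (W.erase w) with hW'
  have hcard : W'.card = W.card := by
    rw [hW', Finset.card_insert_of_notMem (by simp [hx]), Finset.card_erase_of_mem hw]
    have := Finset.card_pos.2 ⟨w, hw⟩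
    omega
  have hw' : w ∉ W' := by simp [hW', Ne.symm hxw]
  have h1 := sum_defect_le (G := G) (w := w) hx
  have h2 := sum_defect_le (G := G) (w := x) hw'
  rw [hcard] at h2
  have h3 : ∑ l ∈ indPaths G w W x, (defect G W' l.reverse : ℝ) ≤
      ∑ l ∈ indPaths G x W' w, (defect G W' l : ℝ) := by
    rw [← Finset.sum_image (s := indPaths G w W x) (g := List.reverse)
      (f := fun l => (defect G W' l : ℝ)) (by intro a _ b _ h; simpa using h)]
    refine Finset.sum_le_sum_of_subset_of_nonneg ?_ fun _ _ _ => by positivity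
    intro l hl
    obtain ⟨t, ht, rfl⟩ := Finset.mem_image.1 hl
    exact reverse_mem_indPaths hxw ht
  have h4 := card_indPaths_le (G := G) (w := w) hx
  calc ∑ l ∈ indPaths G w W x, (straddle G W k l : ℝ)
      ≤ ∑ l ∈ indPaths G w W x,
          (3 * (defect G W l : ℝ) + (defect G W' l.reverse : ℝ) + 4) := by
        refine Finset.sum_le_sum fun l hl => ?_
        exact_mod_cast straddle_le hx hxw hl k
    _ = 3 * ∑ l ∈ indPaths G w W x, (defect G W l : ℝ) +
          ∑ l ∈ indPaths G w W x, (defect G W' l.reverse : ℝ) +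
          4 * (indPaths G w W x).card := by
        rw [Finset.sum_add_distrib, Finset.sum_add_distrib, Finset.mul_sum, Finset.sum_const,
          nsmul_eq_mul]; ring
    _ ≤ 138 * cbrt3 ^ W.card := by
        have := pow_nonneg cbrt3_pos.le W.card
        linarith

end Weights

/-! ### The normalised path count and irreducible configurations -/

section Ratio

variable {V : Type*} [DecidableEq V] [Fintype V] (G : SimpleGraph V) [DecidableRel G.Adj]

/-- The number of induced paths from `x` to `w` through `W`, relative to `3 ^ (|W| / 3)`. -/
noncomputable def ratio (w : V) (W : Finset V) (x : V) : ℝ :=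
  (indPaths G w W x).card / cbrt3 ^ W.card

/-- No deletion of at most `m` vertices, combined with an arbitrary change of the starting vertex,
increases the ratio by more than a factor `1 + δ`. -/
def PathIrreducible (w : V) (W : Finset V) (x : V) (m : ℕ) (δ : ℝ) : Prop :=
  ∀ W' ⊆ W, ∀ x' ∉ W', W.card ≤ W'.card + m → ratio G w W' x' ≤ (1 + δ) * ratio G w W x

variable {G} {w x : V} {W : Finset V}

theorem card_eq_ratio_mul :
    ((indPaths G w W x).card : ℝ) = ratio G w W x * cbrt3 ^ W.card := by
  rw [ratio, div_mul_cancel₀]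
  exact pow_ne_zero _ cbrt3_pos.ne'

theorem ratio_nonneg : 0 ≤ ratio G w W x :=
  div_nonneg (Nat.cast_nonneg _) (pow_nonneg cbrt3_pos.le _)

theorem ratio_le_one (hx : x ∉ W) : ratio G w W x ≤ 1 :=
  div_le_one_of_le₀ (card_indPaths_le hx) (pow_nonneg cbrt3_pos.le _)

/-- The recursion in normalised form. For exactly three neighbours the ratio of a node is the mean
of the ratios of its children. -/
theorem ratio_mul_pow (hx : x ∉ W) (hxw : x ≠ w) :
    ratio G w W x * cbrt3 ^ (nb G W x).card = ∑ v ∈ nb G W x, ratio G w (rem G W [x]) v := by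
  have h := card_indPaths (G := G) hx hxw
  have hc := card_rem_add (G := G) (W := W) (x := x)
  have h0 := cbrt3_pos
  simp only [ratio]
  rw [← Finset.sum_div, h, ← hc, pow_add]
  push_cast
  field_simp

theorem exists_ratio_le (hx : x ∉ W) (hxw : x ≠ w) (hr : 0 < ratio G w W x) :
    ∃ v ∈ nb G W x, ratio G w W x *
      (1.03 : ℝ) ^ (((nb G W x).card - 3) + (3 - (nb G W x).card)) ≤
        ratio G w (rem G W [x]) v := by
  by_contra! hcon
  have h1 := ratio_mul_pow (G := G) hx hxw
  set d := (nb G W x).card with hd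
  rcases Finset.eq_empty_or_nonempty (nb G W x) with h | h
  · rw [hd, h] at h1; simp at h1; exact hr.ne' h1
  · have h2 := Finset.sum_lt_sum_of_nonempty h hcon
    rw [Finset.sum_const, nsmul_eq_mul, ← h1, ← hd] at h2
    have h3 := mul_le_mul_of_nonneg_left (mul_pow_le_cbrt3_pow d) hr.le
    linarith

/-- A node of large degree has a child whose ratio is larger by a power of 1.03, and no ratio
exceeds 1. -/
theorem exists_card_nb_le {ρ : ℝ} (hρ : 0 < ρ) :
    ∃ D : ℕ, ∀ {V : Type*} [DecidableEq V] [Fintype V] (G : SimpleGraph V) [DecidableRel G.Adj]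
      (w : V) (W : Finset V) (x : V), x ∉ W → x ≠ w → ρ ≤ ratio G w W x →
        (nb G W x).card ≤ D := by
  obtain ⟨n, hn⟩ := pow_unbounded_of_one_lt (1 / ρ) (show (1 : ℝ) < 1.03 by norm_num)
  refine ⟨n + 3, ?_⟩
  intro V _ _ G _ w W x hx hxw hr
  obtain ⟨v, hv, h⟩ := exists_ratio_le hx hxw (hρ.trans_le hr)
  have h1 := h.trans (ratio_le_one (notMem_rem_of_mem_nb hv))
  by_contra! hcon
  have h2 : (1.03 : ℝ) ^ n ≤ 1.03 ^ (((nb G W x).card - 3) + (3 - (nb G W x).card)) :=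
    pow_le_pow_right₀ (by norm_num) (by omega)
  have h3 : ρ * (1 / ρ) < ratio G w W x *
      1.03 ^ (((nb G W x).card - 3) + (3 - (nb G W x).card)) :=
    mul_lt_mul_of_le_of_lt_of_pos_of_nonneg hr (hn.trans_le h2) hρ (by positivity)
  rw [mul_one_div_cancel hρ.ne'] at h3
  linarith

theorem card_filter_notMem {y : V} (hy : y ∈ W) (hx : x ∉ W) :
    ((indPaths G w W x).filter fun l => y ∉ l) = indPaths G w (W.erase y) x := by
  ext l
  rw [Finset.mem_filter, mem_indPaths, mem_indPaths]
  constructor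
  · rintro ⟨⟨⟨h1, h2, h3⟩, h4⟩, h5⟩
    exact ⟨⟨h1, h2, fun c hc => Finset.mem_erase.2
      ⟨fun e => h5 (e ▸ List.mem_of_mem_tail hc), h3 c hc⟩⟩, h4⟩
  · rintro ⟨⟨h1, h2, h3⟩, h4⟩
    refine ⟨⟨⟨h1, h2, fun c hc => Finset.mem_of_mem_erase (h3 c hc)⟩, h4⟩, fun h => ?_⟩
    rcases l with _ | ⟨a, l⟩
    · simp at h
    · obtain rfl : a = x := by simpa using h2
      rcases List.mem_cons.1 h with rfl | h
      · exact hx hy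
      · exact (Finset.mem_erase.1 (h3 y h)).1 rfl

/-- Up to depth `M`, the tree of induced paths from `x` is ternary, its branches carry about
equally many paths, and every remaining vertex lies on many of them. -/
structure TernaryTree (G : SimpleGraph V) [DecidableRel G.Adj] (w : V) (W : Finset V) (x : V)
    (M : ℕ) : Prop where
  notMem : x ∉ W
  pos : 0 < ratio G w W x
  ne : ∀ {A a}, IsPre G W x (A ++ [a]) → A.length ≤ M → a ≠ w
  card_nb : ∀ {A a}, IsPre G W x (A ++ [a]) → A.length ≤ M → (nb G (rem G W A) a).card = 3
  card_rem : ∀ {A a}, IsPre G W x (A ++ [a]) → A.length ≤ M →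
    (rem G W A).card + 3 * A.length = W.card
  le_ratio : ∀ {A a}, IsPre G W x (A ++ [a]) → A.length ≤ M →
    0.99 * ratio G w W x ≤ ratio G w (rem G W A) a
  ratio_le : ∀ {A a}, IsPre G W x (A ++ [a]) → A.length ≤ M →
    ratio G w (rem G W A) a ≤ 1.01 * ratio G w W x
  hit : ∀ {A a}, IsPre G W x (A ++ [a]) → A.length ≤ M → ∀ y ∈ rem G W A,
    0.3 * ((indPaths G w (rem G W A) a).card : ℝ) ≤
      ((indPaths G w (rem G W A) a).filter fun l => y ∈ l).card

/-- Every node to depth `M` arises from the root by deleting few vertices, so its ratio is at most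
(1 + δ) times that of the root. A degree other than three would give some child a gain of 1.03. With
degree three the ratios average, so an upper bound for all children is also a lower bound for each.
The bound `D` keeps the deletion of one more neighbourhood within the budget `m`. -/
theorem PathIrreducible.ternaryTree {m M D : ℕ} {δ : ℝ} (hirr : PathIrreducible G w W x m δ)
    (hx : x ∉ W) (hxw : x ≠ w) (hr : 0 < ratio G w W x) (hδ : 0 < δ)
    (hM : 4 ^ (M + 2) * δ ≤ 1 / 1000) (hm : 3 * M + D + 3 ≤ m)
    (hD : ∀ (W' : Finset V) (x' : V), x' ∉ W' → x' ≠ w →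
      ratio G w W x / 2 ≤ ratio G w W' x' → (nb G W' x').card ≤ D) :
    TernaryTree G w W x M := by
  set r := ratio G w W x with hrdef
  have hpow : ∀ k ≤ M + 2, (4 : ℝ) ^ k * δ ≤ 1 / 1000 := fun k hk =>
    (mul_le_mul_of_nonneg_right (pow_le_pow_right₀ (by norm_num) hk) hδ.le).trans hM
  have hδ' : δ ≤ 1 / 1000 := by simpa using hpow 0 (by omega)
  have hup : ∀ {A a}, IsPre G W x (A ++ [a]) → (rem G W A).card + 3 * A.length = W.card →
      A.length ≤ M → ∀ W' ⊆ rem G W A, ∀ x' ∉ W', (rem G W A).card ≤ W'.card + (D + 3) →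
        ratio G w W' x' ≤ (1 + δ) * r := by
    intro A a _ h2 h3 W' hW' x' hx' h4
    exact hirr W' (hW'.trans rem_subset) x' hx' (by omega)
  have hthree : ∀ {A a}, IsPre G W x (A ++ [a]) → (rem G W A).card + 3 * A.length = W.card →
      A.length ≤ M → a ≠ w → 0.999 * r ≤ ratio G w (rem G W A) a →
        (nb G (rem G W A) a).card = 3 := by
    intro A a h1 h2 h3 h4 h5
    have ha : a ∉ rem G W A := h1.notMem_rem hx a (by simp)
    have hd := hD _ a ha h4 (by linarith)
    by_contra hne
    obtain ⟨v, hv, h6⟩ := exists_ratio_le ha h4 (by linarith)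
    have hc := card_rem_add (G := G) (W := rem G W A) (x := a)
    have h7 := hup h1 h2 h3 _ (rem_subset (A := [a])) v (notMem_rem_of_mem_nb hv) (by omega)
    have h8 : (1.03 : ℝ) ≤ 1.03 ^ (((nb G (rem G W A) a).card - 3) +
        (3 - (nb G (rem G W A) a).card)) := by
      refine le_self_pow₀ (by norm_num) ?_
      omega
    have h9 := mul_le_mul h5 h8 (by norm_num) ratio_nonneg
    nlinarith
  have main : ∀ A a, IsPre G W x (A ++ [a]) → A.length ≤ M → a ≠ w ∧
      (rem G W A).card + 3 * A.length = W.card ∧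
      (1 - 4 ^ (A.length + 1) * δ) * r ≤ ratio G w (rem G W A) a := by
    intro A
    induction A using List.reverseRecOn with
    | nil =>
      intro a h _
      obtain rfl : a = x := by simpa using h.2.1
      refine ⟨hxw, by simp, ?_⟩
      rw [rem_nil, ← hrdef]
      have : 0 < 4 ^ (([] : List V).length + 1) * δ * r := by positivity
      linarith
    | append_singleton A b ih =>
      intro a h hl
      rw [List.length_append, List.length_singleton] at hl
      have hb : IsPre G W x (A ++ [b]) := h.of_append (by simp)
      obtain ⟨h1, h2, h3⟩ := ih b hb (by omega)
      have hbn : b ∉ rem G W A := hb.notMem_rem hx b (by simp)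
      have hp1 := hpow (A.length + 1) (by omega)
      have h4 := hthree hb h2 (by omega) h1 (by nlinarith)
      have hc := card_rem_add (G := G) (W := rem G W A) (x := b)
      have ha : a ∈ nb G (rem G W A) b := by
        have := (IsPre.append hx hb (T := [a])).1 (by simpa using h)
        refine mem_nb.2 ⟨this.2.2 a (by simp), (this.1.2.1 a (by simp)).2 rfl⟩
      have h5 := ratio_mul_pow (G := G) (w := w) hbn h1
      rw [h4, cbrt3_pow_three] at h5
      have h6 : ∀ v ∈ nb G (rem G W A) b, ratio G w (rem G (rem G W A) [b]) v ≤ (1 + δ) * r :=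
        fun v hv => hup hb h2 (by omega) _ rem_subset v (notMem_rem_of_mem_nb hv) (by omega)
      -- A child has three times the ratio of its parent minus its two siblings, which have at most
      -- (1 + δ) r each. A relative loss ε ≥ 4δ at the parent becomes at most 3ε + 2δ ≤ 4ε, whence
      -- the powers of 4.
      have low : ∀ v ∈ nb G (rem G W A) b,
          (1 - 4 ^ (A.length + 1 + 1) * δ) * r ≤ ratio G w (rem G (rem G W A) [b]) v := by
        intro v hv
        have h7 : ∑ u ∈ (nb G (rem G W A) b).erase v, ratio G w (rem G (rem G W A) [b]) u ≤
            2 * ((1 + δ) * r) := by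
          refine (Finset.sum_le_card_nsmul _ _ _ fun u hu => h6 u (Finset.mem_of_mem_erase hu)).trans ?_
          rw [Finset.card_erase_of_mem hv, h4]
          simp
        have h8 := Finset.add_sum_erase _ (fun u => ratio G w (rem G (rem G W A) [b]) u) hv
        have h9 : (4 : ℝ) ^ (A.length + 1 + 1) = 4 * 4 ^ (A.length + 1) := by rw [pow_succ]; ring
        have h10 : (4 : ℝ) ≤ 4 ^ (A.length + 1) := by
          exact le_self_pow₀ (by norm_num) (by omega)
        have h11 : 4 * (δ * r) ≤ 4 ^ (A.length + 1) * (δ * r) :=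
          mul_le_mul_of_nonneg_right h10 (by positivity)
        rw [h9]
        nlinarith
      rw [rem_append, List.length_append, List.length_singleton]
      refine ⟨?_, by omega, low a ha⟩
      -- If the path could end here, every sibling would be unable to reach `w`, which has just been
      -- seen; its ratio would be 0 and contradict `low`.
      rintro rfl
      obtain ⟨v, hv, hva⟩ : ∃ v ∈ nb G (rem G W A) b, v ≠ a := by
        by_contra! hcon
        have : nb G (rem G W A) b ⊆ {a} := fun v hv => Finset.mem_singleton.2 (hcon v hv)
        have := Finset.card_le_card this
        rw [h4] at this; simp at this
      have h12 := low v hv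
      have h13 : ratio G a (rem G (rem G W A) [b]) v = 0 := by
        rw [ratio, indPaths_eq_empty hva (notMem_rem_of_mem_nb ha)]; simp
      have hp2 := hpow (A.length + 1 + 1) (by omega)
      rw [h13] at h12
      nlinarith
  have main' : ∀ {A a}, IsPre G W x (A ++ [a]) → A.length ≤ M →
      0.999 * r ≤ ratio G w (rem G W A) a := fun {A a} h hl => by
    have h1 := (main A a h hl).2.2
    have h2 := hpow (A.length + 1) (by omega)
    nlinarith
  refine ⟨hx, hr, fun h hl => (main _ _ h hl).1, fun h hl => ?_, fun h hl => (main _ _ h hl).2.1,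
    fun h hl => ?_, fun {A a} h hl => ?_, fun {A a} h hl y hy => ?_⟩
  · obtain ⟨h1, h2, -⟩ := main _ _ h hl
    exact hthree h h2 hl h1 (main' h hl)
  · have := main' h hl
    linarith
  · have := hup h (main _ _ h hl).2.1 hl _ subset_rfl a (h.notMem_rem hx a (by simp)) (by omega)
    nlinarith
  · have ha : a ∉ rem G W A := h.notMem_rem hx a (by simp)
    -- Deleting `y` does not raise the ratio noticeably, yet the normalisation drops by a factor c.
    -- So the paths that avoid `y` are at most about 1/c < 0.7 of all.
    have h1 := hup h (main _ _ h hl).2.1 hl ((rem G W A).erase y) (Finset.erase_subset _ _) a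
      (fun h' => ha (Finset.mem_of_mem_erase h')) (by rw [Finset.card_erase_of_mem hy]; omega)
    have h2 := main' h hl
    have h3 := Finset.card_filter_add_card_filter_not (s := indPaths G w (rem G W A) a)
      (fun l => y ∈ l)
    rw [card_filter_notMem hy ha] at h3
    have h4 : (((indPaths G w (rem G W A) a).filter fun l => y ∈ l).card : ℝ) +
        ((indPaths G w ((rem G W A).erase y) a).card : ℝ) = (indPaths G w (rem G W A) a).card := by
      exact_mod_cast h3
    rw [card_eq_ratio_mul (W := (rem G W A).erase y), Finset.card_erase_of_mem hy] at h4
    rw [card_eq_ratio_mul (W := rem G W A)] at h4 ⊢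
    have h5 : (0 : ℝ) < cbrt3 ^ ((rem G W A).card - 1) := pow_pos cbrt3_pos _
    have h6 : cbrt3 ^ (rem G W A).card = cbrt3 ^ ((rem G W A).card - 1) * cbrt3 := by
      rw [← pow_succ, Nat.sub_add_cancel (Finset.card_pos.2 ⟨y, hy⟩)]
    set q := cbrt3 ^ ((rem G W A).card - 1)
    rw [h6] at h4 ⊢
    have h7 : (1.44 : ℝ) ≤ cbrt3 := le_cbrt3 (by norm_num)
    have h8 : ratio G w ((rem G W A).erase y) a ≤
        0.7 * (ratio G w (rem G W A) a * cbrt3) := by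
      have h9 := mul_le_mul h2 h7 (by norm_num) ratio_nonneg
      nlinarith
    have h10 := mul_le_mul_of_nonneg_right h8 h5.le
    linarith

end Ratio

theorem List.exists_last_split {α : Type*} {p : α → Prop} {l : List α} (h : ∃ a ∈ l, p a) :
    ∃ P a S, l = P ++ a :: S ∧ p a ∧ ∀ c ∈ S, ¬ p c := by
  induction l with
  | nil => simp at h
  | cons b l ih =>
    by_cases h' : ∃ a ∈ l, p a
    · obtain ⟨P, a, S, rfl, h1, h2⟩ := ih h'
      exact ⟨b :: P, a, S, rfl, h1, h2⟩
    · push Not at h'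
      obtain ⟨a, ha, hp⟩ := h
      rcases List.mem_cons.1 ha with rfl | ha
      · exact ⟨[], a, l, rfl, hp, h'⟩
      · exact absurd hp (h' a ha)

theorem List.exists_first_split {α : Type*} {p : α → Prop} {l : List α} (h : ∃ a ∈ l, p a) :
    ∃ P a S, l = P ++ a :: S ∧ p a ∧ ∀ c ∈ P, ¬ p c := by
  obtain ⟨P, a, S, h1, h2, h3⟩ := List.exists_last_split (p := p) (l := l.reverse) (by simpa using h)
  refine ⟨S.reverse, a, P.reverse, ?_, h2, by simpa using h3⟩
  rw [← List.reverse_reverse l, h1]; simp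

theorem List.exists_split_of_lt {α : Type*} {l : List α} {i : ℕ} (h : i < l.length) :
    ∃ A a T, l = A ++ a :: T ∧ A.length = i :=
  ⟨l.take i, l[i], l.drop (i + 1), by simp, by simp; omega⟩

/-! ### Nodes whose children agree, and chords at the other nodes -/

section Homogeneous

variable {V : Type*} {G : SimpleGraph V}

/-- If `A₁, A₂, A₃` are consecutive clusters and nothing but `A₂` is attached to `A₁`, an induced
path cannot leave `A₁` again once it has entered it from outside. -/
theorem IsInd.notMem_of_dead_end {w : V} {W A₁ A₂ A₃ : Finset V} (hw₁ : w ∉ A₁) (hw₂ : w ∉ A₂)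
    (h₁ : ∀ a ∈ A₁, ∀ u ∈ W, G.Adj a u → u ∈ A₁ ∨ u ∈ A₂) (h₁₂ : ∀ a ∈ A₁, ∀ u ∈ A₂, G.Adj a u)
    (h₂ : ∀ a ∈ A₂, ∀ u ∈ W, G.Adj a u → u ∈ A₁ ∨ u ∈ A₂ ∨ u ∈ A₃)
    (h₂₃ : ∀ a ∈ A₂, ∀ u ∈ A₃, G.Adj a u) {l : List V} (hl : IsInd G l) (hlW : ∀ c ∈ l, c ∈ W)
    (hhead : ∀ y, l.head? = some y → y ∉ A₁) (hlast : l.getLast? = some w) :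
    ∀ a ∈ A₁, a ∉ l := by
  intro a₀ ha₀ hal₀
  -- Around the last visit `a` to `A₁`, the predecessor `p` and the successor `s` both lie in `A₂`.
  -- The vertex `t` after `s` cannot be in `A₁` by the choice of `a`, nor in `A₂`, where it would be
  -- adjacent to `a`, nor in `A₃`, where it would be adjacent to `p`.
  obtain ⟨P, a, S, rfl, ha, hS⟩ := List.exists_last_split (p := (· ∈ A₁)) ⟨a₀, hal₀, ha₀⟩
  rcases S with _ | ⟨s, S⟩
  · simp at hlast; exact hw₁ (hlast ▸ ha)
  have hl' := hl
  rw [show P ++ a :: s :: S = (P ++ [a]) ++ s :: S by simp, isInd_append] at hl'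
  have has : G.Adj a s := (hl'.2.2 a (by simp) s (by simp)).2.2 (by simp)
  have hs : s ∈ A₂ := (h₁ a ha s (hlW s (by simp)) has).resolve_left (hS s (by simp))
  have hnd := hl.nodup
  rcases P.eq_nil_or_concat with rfl | ⟨P, p, rfl⟩
  · exact hhead a (by simp) ha
  have hp : p ∉ A₁ := by
    intro hp
    have := (hl'.2.2 p (by simp) s (by simp)).2.1 (h₁₂ p hp s hs)
    have e : a = p := by simpa using this.1
    subst e
    simp [List.nodup_append] at hnd
  have hpa : G.Adj a p := by
    rw [isInd_append] at hl
    exact ((hl.2.2 p (by simp) a (by simp)).2.2 (by simp)).symm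
  have hp₂ : p ∈ A₂ := (h₁ a ha p (hlW p (by simp)) hpa).resolve_left hp
  rcases S with _ | ⟨t, S⟩
  · simp at hlast; exact hw₂ (hlast ▸ hs)
  have hst : G.Adj s t := (hl'.2.1.2.1 t (by simp)).2 rfl
  have hne : s ≠ t := hst.ne
  rcases h₂ s hs t (hlW t (by simp)) hst with h | h | h
  · exact hS t (by simp) h
  · have := (hl'.2.2 a (by simp) t (by simp)).2.1 (h₁₂ a ha t h)
    exact hne (by simpa using this.2)
  · have := (hl'.2.2 p (by simp) t (by simp)).2.1 (h₂₃ p hp₂ t h)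
    exact hne (by simpa using this.2)

variable [DecidableEq V] [Fintype V] [DecidableRel G.Adj] {w x : V} {W : Finset V} {M : ℕ}

variable (G) in
/-- All neighbours of `x` in `W` have the same neighbours among the other vertices of `W`. -/
def HomogeneousAt (W : Finset V) (x : V) : Prop :=
  ∀ v ∈ nb G W x, ∀ v' ∈ nb G W x, nb G (rem G W [x]) v = nb G (rem G W [x]) v'

theorem IsPre.snoc (hx : x ∉ W) {A : List V} {a b : V} (h : IsPre G W x (A ++ [a]))
    (hb : b ∈ nb G (rem G W A) a) : IsPre G W x (A ++ [a] ++ [b]) := by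
  rw [List.append_assoc, List.singleton_append]
  exact (h.append hx).2 (isPre_pair hb)

/-- Agreement at two consecutive nodes `b`, `e` passes up to their parent `a`. The two nodes provide
consecutive clusters A₁, A₂, A₃ with A₁ attached only to A₂. If a sibling `v` of `b` sees a vertex
`y` outside A₁, it misses some `z` in A₁, as both see three vertices. By `hit` some induced path
from `y` visits `z`, but A₁ is a dead end. -/
theorem TernaryTree.homogeneousAt (hT : TernaryTree G w W x M) {A : List V} {a b e : V}
    (h : IsPre G W x (A ++ [a])) (hA : A.length + 3 ≤ M) (hb : b ∈ nb G (rem G W A) a)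
    (he : e ∈ nb G (rem G W (A ++ [a])) b) (hbh : HomogeneousAt G (rem G W (A ++ [a])) b)
    (heh : HomogeneousAt G (rem G W (A ++ [a] ++ [b])) e) : HomogeneousAt G (rem G W A) a := by
  have hx := hT.notMem
  set W' := rem G W (A ++ [a]) with hW'
  have hW'' : rem G W (A ++ [a] ++ [b]) = rem G W' [b] := rem_append
  have hrem : rem G (rem G W A) [a] = W' := rem_append.symm
  have hpb := h.snoc hx hb
  have hpe := hpb.snoc hx he
  suffices key : ∀ v ∈ nb G (rem G W A) a, nb G W' v = nb G W' b by
    intro v hv v' hv'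
    rw [hrem, key v hv, key v' hv']
  intro v hv
  have hpv := h.snoc hx hv
  have hcv : (nb G W' v).card = 3 := hT.card_nb hpv (by simp; omega)
  have hcb : (nb G W' b).card = 3 := hT.card_nb hpb (by simp; omega)
  by_contra hne
  obtain ⟨y, hyv, hyb⟩ : ∃ y ∈ nb G W' v, y ∉ nb G W' b := by
    by_contra! hcon
    exact hne (Finset.eq_of_subset_of_card_le hcon (by omega))
  obtain ⟨z, hzb, hzv⟩ : ∃ z ∈ nb G W' b, z ∉ nb G W' v := by
    by_contra! hcon
    exact hne (Finset.eq_of_subset_of_card_le hcon (by omega)).symm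
  have hpy := hpv.snoc hx hyv
  have hzmem : z ∈ rem G W (A ++ [a] ++ [v]) := by
    rw [rem_append, mem_rem_singleton]
    exact ⟨(mem_nb.1 hzb).1, fun hadj => hzv (mem_nb.2 ⟨(mem_nb.1 hzb).1, hadj⟩)⟩
  have hhit := hT.hit hpy (by simp; omega) z hzmem
  have hpos : 0 < (indPaths G w (rem G W (A ++ [a] ++ [v])) y).card := by
    have h1 := hT.le_ratio hpy (by simp; omega)
    have h2 := hT.pos
    have h3 : 0 < ratio G w (rem G W (A ++ [a] ++ [v])) y := by linarith
    have h4 := card_eq_ratio_mul (G := G) (w := w) (W := rem G W (A ++ [a] ++ [v])) (x := y)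
    have h5 := mul_pos h3 (pow_pos cbrt3_pos (rem G W (A ++ [a] ++ [v])).card)
    rw [← h4] at h5
    exact_mod_cast h5
  obtain ⟨l, hl⟩ : ((indPaths G w (rem G W (A ++ [a] ++ [v])) y).filter fun l => z ∈ l).Nonempty := by
    rw [← Finset.card_pos]
    have : (0 : ℝ) < 0.3 * ((indPaths G w (rem G W (A ++ [a] ++ [v])) y).card : ℝ) := by positivity
    exact_mod_cast this.trans_le hhit
  obtain ⟨hl, hzl⟩ := Finset.mem_filter.1 hl
  obtain ⟨⟨hl1, hl2, hl3⟩, hl4⟩ := mem_indPaths.1 hl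
  have hA2 : ∀ a' ∈ nb G W' b, nb G (rem G W' [b]) a' = nb G (rem G W' [b]) e :=
    fun a' ha' => hbh a' ha' e he
  have hsub : ∀ u ∈ rem G W (A ++ [a] ++ [v]), u ∈ W' := fun u hu => by
    rw [rem_append] at hu; exact rem_subset hu
  rcases Finset.eq_empty_or_nonempty (nb G (rem G W' [b]) e) with hemp | ⟨f, hf⟩
  · have : (nb G (rem G W (A ++ [a] ++ [b])) e).card = 3 := hT.card_nb hpe (by simp; omega)
    rw [hW'', hemp] at this; simp at this
  refine IsInd.notMem_of_dead_end (W := W') (A₁ := nb G W' b) (A₂ := nb G (rem G W' [b]) e)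
    (A₃ := nb G (rem G (rem G W' [b]) [e]) f) ?_ ?_ ?_ ?_ ?_ ?_ hl1 ?_ ?_ hl4 z hzb hzl
  · intro hw
    exact hT.ne (hpb.snoc hx hw) (by simp; omega) rfl
  · intro hw
    rw [← hW''] at hw
    exact hT.ne (hpe.snoc hx hw) (by simp; omega) rfl
  · intro a' ha' u hu hadj
    by_cases hbu : G.Adj b u
    · exact .inl (mem_nb.2 ⟨hu, hbu⟩)
    · right
      rw [← hA2 a' ha']
      exact mem_nb.2 ⟨mem_rem_singleton.2 ⟨hu, hbu⟩, hadj⟩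
  · intro a' ha' u hu
    rw [← hA2 a' ha'] at hu
    exact (mem_nb.1 hu).2
  · intro a' ha' u hu hadj
    by_cases hbu : G.Adj b u
    · exact .inl (mem_nb.2 ⟨hu, hbu⟩)
    · right
      have hu' : u ∈ rem G W' [b] := mem_rem_singleton.2 ⟨hu, hbu⟩
      by_cases heu : G.Adj e u
      · exact .inl (mem_nb.2 ⟨hu', heu⟩)
      · right
        rw [hW''] at heh
        rw [← heh a' ha' f hf]
        exact mem_nb.2 ⟨mem_rem_singleton.2 ⟨hu', heu⟩, hadj⟩
  · intro a' ha' u hu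
    rw [hW''] at heh
    rw [← heh a' ha' f hf] at hu
    exact (mem_nb.1 hu).2
  · intro c hc
    rcases l with _ | ⟨y', l⟩
    · simp at hc
    · obtain rfl : y' = y := by simpa using hl2
      rcases List.mem_cons.1 hc with rfl | hc
      · exact (mem_nb.1 hyv).1
      · exact hsub c (hl3 c hc)
  · intro y' hy'
    rw [hl2] at hy'
    obtain rfl : y = y' := by simpa using hy'
    exact hyb

theorem TernaryTree.lt_length (hT : TernaryTree G w W x M) {l : List V}
    (hl : l ∈ indPaths G w W x) : M + 1 < l.length := by
  obtain ⟨h1, h2⟩ := mem_indPaths.1 hl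
  by_contra! hcon
  rcases l.eq_nil_or_concat with rfl | ⟨A, a, rfl⟩
  · simp at h2
  · rw [List.concat_eq_append] at h1 h2 hcon
    exact hT.ne h1 (by simp at hcon; omega) (by simpa using h2)

theorem IsPre.mem_nb_of_append (hx : x ∉ W) {A T : List V} {a b : V}
    (h : IsPre G W x (A ++ a :: b :: T)) : b ∈ nb G (rem G W A) a := by
  have h1 : IsPre G W x (A ++ [a]) := IsPre.of_append (B := b :: T) (by simp) (by simpa using h)
  have h2 := (h1.append hx).1 h
  exact mem_nb.2 ⟨h2.2.2 b (by simp), (h2.1.2.1 b (by simp)).2 rfl⟩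

/-- If the root is not homogeneous, then of two consecutive vertices of a path one is not. -/
theorem TernaryTree.not_homogeneousAt_succ (hT : TernaryTree G w W x M)
    (hroot : ¬ HomogeneousAt G W x) {l : List V} (hl : l ∈ indPaths G w W x) {A T : List V}
    {a b : V} (hAl : l = A ++ a :: b :: T) (hA : A.length + 2 ≤ M)
    (h1 : HomogeneousAt G (rem G W A) a) : ¬ HomogeneousAt G (rem G W (A ++ [a])) b := by
  have hx := hT.notMem
  have hpre := (mem_indPaths.1 hl).1
  induction A using List.reverseRecOn generalizing a b T with
  | nil =>
    subst hAl
    obtain rfl : a = x := by simpa using hpre.2.1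
    simp at h1; exact absurd h1 hroot
  | append_singleton A a₀ ih =>
    intro h2
    rw [List.length_append, List.length_singleton] at hA
    have e1 : l = A ++ a₀ :: a :: b :: T := by simp [hAl]
    have h3 : IsPre G W x (A ++ [a₀]) :=
      IsPre.of_append (B := a :: b :: T) (by simp) (by simpa [e1] using hpre)
    have h4 : a ∈ nb G (rem G W A) a₀ := IsPre.mem_nb_of_append hx (e1 ▸ hpre)
    have h5 : b ∈ nb G (rem G W (A ++ [a₀])) a := IsPre.mem_nb_of_append hx (hAl ▸ hpre)
    exact ih e1 (by omega) (hT.homogeneousAt h3 (by omega) h4 h5 h1 h2) h1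

theorem card_filter_prefix_and (hx : x ∉ W) {A : List V} {a : V} (h : IsPre G W x (A ++ [a]))
    (p : List V → Prop) [DecidablePred p] :
    ((indPaths G w W x).filter fun l => A ++ [a] <+: l ∧ p l).card =
      ((indPaths G w (rem G W A) a).filter fun T => p (A ++ T)).card := by
  symm
  refine Finset.card_bij (fun T _ => A ++ T) ?_ ?_ ?_
  · intro T hT
    obtain ⟨hT, hp⟩ := Finset.mem_filter.1 hT
    have h2 := (mem_indPaths.1 hT).1.2.1
    rcases T with _ | ⟨b, T⟩
    · simp at h2
    · obtain rfl : b = a := by simpa using h2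
      exact Finset.mem_filter.2 ⟨(append_mem_indPaths hx h).2 hT, ⟨T, by simp⟩, hp⟩
  · intro T _ T' _ e; simpa using e
  · intro l hl
    obtain ⟨hl, ⟨T, rfl⟩, hp⟩ := Finset.mem_filter.1 hl
    refine ⟨a :: T, Finset.mem_filter.2 ⟨?_, by simpa using hp⟩, by simp⟩
    rw [List.append_assoc, List.singleton_append] at hl
    exact (append_mem_indPaths hx h).1 hl

theorem TernaryTree.le_card_filter (hT : TernaryTree G w W x M) {A : List V} {a : V}
    (h : IsPre G W x (A ++ [a])) (hA : A.length ≤ M) {y : V} (hy : y ∈ rem G W A)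
    (p : List V → Prop) [DecidablePred p]
    (hp : ∀ T, a :: T ∈ indPaths G w (rem G W A) a → y ∈ T → p (A ++ a :: T)) :
    0.3 * (((indPaths G w W x).filter fun l => A ++ [a] <+: l).card : ℝ) ≤
      ((indPaths G w W x).filter fun l => A ++ [a] <+: l ∧ p l).card := by
  rw [card_filter_prefix hT.notMem h, card_filter_prefix_and hT.notMem h]
  refine (hT.hit h hA y hy).trans ?_
  have hya : y ≠ a := fun e => h.notMem_rem hT.notMem a (by simp) (e ▸ hy)
  gcongr with l hl
  intro hyl
  have h2 := (mem_indPaths.1 hl).1.2.1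
  rcases l with _ | ⟨b, T⟩
  · simp at h2
  · obtain rfl : b = a := by simpa using h2
    exact hp T hl (by simpa [hya] using hyl)

variable (G) in
/-- Some vertex of `W` has its first neighbour on `l` at position `i` and another one at
position `i + 3` or later. -/
def HasChord (W : Finset V) (i : ℕ) (l : List V) : Prop :=
  ∃ A a T v, l = A ++ a :: T ∧ A.length = i ∧ v ∈ W ∧ (∀ b ∈ A, ¬ G.Adj b v) ∧ G.Adj a v ∧
    ∃ c ∈ T.drop 2, G.Adj v c

-- Disagreement at `a` gives a sibling `v` of `b` that sees a vertex `y` not seen by `b`. At least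
-- 30% of the continuations through `b` visit `y`, and not right after `b`. On these, `v` is
-- adjacent to `a` and to `y`, which comes at least three places later.
open scoped Classical in
theorem TernaryTree.le_card_hasChord (hT : TernaryTree G w W x M) {A : List V} {a b : V}
    (h : IsPre G W x (A ++ [a] ++ [b])) (hA : A.length + 1 ≤ M)
    (hh : ¬ HomogeneousAt G (rem G W A) a) :
    0.3 * (((indPaths G w W x).filter fun l => A ++ [a] ++ [b] <+: l).card : ℝ) ≤
      ((indPaths G w W x).filter fun l => A ++ [a] ++ [b] <+: l ∧ HasChord G W A.length l).card := by
  have hx := hT.notMem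
  have ha : IsPre G W x (A ++ [a]) := h.of_append (by simp)
  have hb : b ∈ nb G (rem G W A) a :=
    IsPre.mem_nb_of_append (T := []) hx (by simpa using h)
  obtain ⟨v, hv, hne⟩ : ∃ v ∈ nb G (rem G W A) a,
      nb G (rem G W (A ++ [a])) v ≠ nb G (rem G W (A ++ [a])) b := by
    by_contra! hcon
    refine hh fun v hv v' hv' => ?_
    rw [← rem_append, hcon v hv, hcon v' hv']
  have hcv := hT.card_nb (ha.snoc hx hv) (by simpa using hA)
  have hcb := hT.card_nb h (by simpa using hA)
  obtain ⟨y, hyv, hyb⟩ : ∃ y ∈ nb G (rem G W (A ++ [a])) v, y ∉ nb G (rem G W (A ++ [a])) b := by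
    by_contra! hcon
    exact hne (Finset.eq_of_subset_of_card_le hcon (by omega))
  have hyW := (mem_nb.1 hyv).1
  refine hT.le_card_filter h (by simpa using hA) hyW _ ?_
  intro T hTm hyT
  obtain ⟨hv1, hv2⟩ := mem_nb.1 hv
  refine ⟨A, a, b :: T, v, by simp, rfl, rem_subset hv1, (mem_rem.1 hv1).2, hv2, y, ?_,
    (mem_nb.1 hyv).2⟩
  rcases T with _ | ⟨t, T⟩
  · simp at hyT
  · rcases List.mem_cons.1 hyT with rfl | hyT
    · exact absurd (mem_nb.2 ⟨hyW, ((mem_indPaths.1 hTm).1.1.2.1 y (by simp)).2 rfl⟩) hyb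
    · simpa using hyT

end Homogeneous

/-! ### Counting chords: long ones, short ones, and the shortcut -/

section Chords

open scoped Classical

variable {V : Type*} {G : SimpleGraph V}
  [Fintype V] {w x : V} {W : Finset V} {M : ℕ}

theorem TernaryTree.le_card_not_homogeneousAt (hT : TernaryTree G w W x M)
    (hroot : ¬ HomogeneousAt G W x) {i : ℕ} (hi : i + 2 ≤ M) :
    (indPaths G w W x).card ≤
      ((indPaths G w W x).filter fun l => ∃ A a T, l = A ++ a :: T ∧ A.length = i ∧
        ¬ HomogeneousAt G (rem G W A) a).card +
      ((indPaths G w W x).filter fun l => ∃ A a T, l = A ++ a :: T ∧ A.length = i + 1 ∧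
        ¬ HomogeneousAt G (rem G W A) a).card := by
  refine le_trans (Finset.card_le_card fun l hl => ?_) (Finset.card_union_le _ _)
  obtain ⟨A, a, T, hAl, hA⟩ := List.exists_split_of_lt (l := l) (i := i)
    (by have := hT.lt_length hl; omega)
  rw [Finset.mem_union, Finset.mem_filter, Finset.mem_filter]
  by_cases h : HomogeneousAt G (rem G W A) a
  · right
    have h3 := hT.lt_length hl
    rcases T with _ | ⟨b, T⟩
    · rw [hAl] at h3; simp at h3; omega
    · exact ⟨hl, A ++ [a], b, T, by simp [hAl], by simp [hA],
        hT.not_homogeneousAt_succ hroot hl hAl (by omega) h⟩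
  · exact .inl ⟨hl, A, a, T, hAl, hA, h⟩

theorem TernaryTree.le_card_filter_hasChord (hT : TernaryTree G w W x M) {i : ℕ}
    (hi : i + 1 ≤ M) :
    0.3 * (((indPaths G w W x).filter fun l => ∃ A a T, l = A ++ a :: T ∧ A.length = i ∧
        ¬ HomogeneousAt G (rem G W A) a).card : ℝ) ≤
      ((indPaths G w W x).filter fun l => HasChord G W i l).card := by
  set t := (indPaths G w W x).image (List.take (i + 2)) with ht
  have hmem : ∀ (p : List V → Prop), ∀ l ∈ (indPaths G w W x).filter p, l.take (i + 2) ∈ t :=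
    fun p l hl => Finset.mem_image_of_mem _ (Finset.mem_filter.1 hl).1
  rw [Finset.card_eq_sum_card_fiberwise (hmem _), Finset.card_eq_sum_card_fiberwise (hmem _)]
  push_cast
  rw [Finset.mul_sum]
  refine Finset.sum_le_sum fun B _ => ?_
  rcases Finset.eq_empty_or_nonempty (((indPaths G w W x).filter fun l => ∃ A a T,
    l = A ++ a :: T ∧ A.length = i ∧ ¬ HomogeneousAt G (rem G W A) a).filter
      fun l => l.take (i + 2) = B) with h | ⟨l₀, h₀⟩
  · rw [h]; simp
  · rw [Finset.mem_filter, Finset.mem_filter] at h₀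
    obtain ⟨⟨hl, A, a, T, rfl, hA, hh⟩, hB⟩ := h₀
    have h3 := hT.lt_length hl
    rcases T with _ | ⟨b, T⟩
    · simp at h3; omega
    have e : A ++ a :: b :: T = (A ++ [a] ++ [b]) ++ T := by simp
    have hBe : B = A ++ [a] ++ [b] := by
      rw [← hB, e, List.take_left' (by simp [hA])]
    have hpre : IsPre G W x (A ++ [a] ++ [b]) :=
      IsPre.of_append (B := T) (by simp) (e ▸ (mem_indPaths.1 hl).1)
    have hiff : ∀ l : List V, A ++ [a] ++ [b] <+: l ↔ l.take (i + 2) = B := by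
      intro l
      rw [List.prefix_iff_eq_take, hBe, eq_comm]
      simp [hA]
    have h4 := hT.le_card_hasChord hpre (by omega) hh
    refine le_trans (mul_le_mul_of_nonneg_left ?_ (by norm_num)) (h4.trans ?_)
    · refine Nat.cast_le.2 (Finset.card_le_card fun l hl => ?_)
      rw [Finset.mem_filter, Finset.mem_filter] at hl
      exact Finset.mem_filter.2 ⟨hl.1.1, (hiff l).2 hl.2⟩
    · refine Nat.cast_le.2 (Finset.card_le_card fun l hl => ?_)
      rw [Finset.mem_filter] at hl
      rw [Finset.mem_filter, Finset.mem_filter]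
      exact ⟨⟨hl.1, hA ▸ hl.2.2⟩, (hiff l).1 hl.2.1⟩

/-- Positions are taken in pairs: every path has a node with disagreeing children in each pair, and
such a node yields a chord on 30% of its continuations. -/
theorem TernaryTree.le_sum_card_hasChord (hT : TernaryTree G w W x M)
    (hroot : ¬ HomogeneousAt G W x) {H : ℕ} (hH : 2 * H + 1 ≤ M) :
    0.3 * H * ((indPaths G w W x).card : ℝ) ≤
      ∑ i ∈ Finset.range (2 * H), (((indPaths G w W x).filter fun l => HasChord G W i l).card : ℝ) := by
  induction H with
  | zero => simp
  | succ H ih =>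
    have h1 : ((indPaths G w W x).card : ℝ) ≤ _ :=
      Nat.cast_le.2 (hT.le_card_not_homogeneousAt hroot (i := 2 * H) (by omega))
    rw [Nat.cast_add] at h1
    have h2 := hT.le_card_filter_hasChord (i := 2 * H) (by omega)
    have h3 := hT.le_card_filter_hasChord (i := 2 * H + 1) (by omega)
    have h4 := ih (by omega)
    rw [show 2 * (H + 1) = 2 * H + 1 + 1 by ring, Finset.sum_range_succ, Finset.sum_range_succ]
    push_cast at h4 ⊢
    linarith

variable (G) in
/-- Some vertex of `W` has its first neighbour on `l` at position `i` and another one at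
position `k` or later. -/
def HasLongChord (W : Finset V) (i k : ℕ) (l : List V) : Prop :=
  ∃ A a T v, l = A ++ a :: T ∧ A.length = i ∧ v ∈ W ∧ (∀ b ∈ A, ¬ G.Adj b v) ∧ G.Adj a v ∧
    ∃ c ∈ l.drop k, G.Adj v c

variable (G) in
/-- Some vertex of `W` has its first neighbour on `l` at position `i` and its last one at
position `i + 1 + q`, where `q ≥ 2`. -/
def HasShortChord (W : Finset V) (i q : ℕ) (l : List V) : Prop :=
  ∃ A a Q b R v, l = A ++ a :: (Q ++ b :: R) ∧ A.length = i ∧ Q.length = q ∧ 2 ≤ q ∧ v ∈ W ∧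
    (∀ c ∈ A, ¬ G.Adj c v) ∧ G.Adj a v ∧ G.Adj v b ∧ ∀ c ∈ R, ¬ G.Adj v c

theorem HasChord.long_or_short {i k L : ℕ} {l : List V} (h : HasChord G W i l)
    (hkL : k ≤ i + L) :
    HasLongChord G W i k l ∨ ∃ q ∈ Finset.range L, HasShortChord G W i q l := by
  obtain ⟨A, a, T, v, rfl, hA, hv, h1, h2, c, hc, hvc⟩ := h
  have hT : T = T.take 2 ++ T.drop 2 := (List.take_append_drop 2 T).symm
  obtain ⟨P, b, R, hPR, hvb, hR⟩ := List.exists_last_split (p := G.Adj v) ⟨c, hc, hvc⟩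
  have hlen : (T.take 2).length = 2 := by
    rw [List.length_take]
    have := List.length_pos_of_mem hc
    rw [List.length_drop] at this
    omega
  have e : A ++ a :: T = A ++ a :: ((T.take 2 ++ P) ++ b :: R) := by
    rw [List.append_assoc, ← hPR, ← hT]
  by_cases hq : (T.take 2 ++ P).length < L
  · exact .inr ⟨_, Finset.mem_range.2 hq, A, a, _, b, R, v, e, hA, rfl,
      by rw [List.length_append]; omega, hv, h1, h2, hvb, hR⟩
  · refine .inl ⟨A, a, T, v, rfl, hA, hv, h1, h2, b, ?_, hvb⟩
    rw [e, show A ++ a :: ((T.take 2 ++ P) ++ b :: R) = (A ++ [a] ++ (T.take 2 ++ P)) ++ b :: R by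
      simp, List.drop_append_of_le_length (by simp at hq ⊢; omega)]
    simp

/-- The position `i` is that of the first neighbour of the witness, so distinct positions have
distinct witnesses, and each witness straddles `k`. -/
theorem card_hasLongChord_le (k : ℕ) (l : List V) :
    ((Finset.range k).filter fun i => HasLongChord G W i k l).card ≤ straddle G W k l := by
  have hch : ∀ i ∈ (Finset.range k).filter fun i => HasLongChord G W i k l,
      ∃ A a T v, l = A ++ a :: T ∧ A.length = i ∧ v ∈ W ∧ (∀ b ∈ A, ¬ G.Adj b v) ∧ G.Adj a v ∧
        ∃ c ∈ l.drop k, G.Adj v c := fun i hi => (Finset.mem_filter.1 hi).2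
  rcases isEmpty_or_nonempty V with hV | hV
  · rw [Finset.filter_false_of_mem fun i hi hc => ?_]
    · simp
    · obtain ⟨-, a, -⟩ := hc
      exact hV.elim a
  choose! A a T v hl hA hv h1 h2 h3 using hch
  refine Finset.card_le_card_of_injOn v ?_ ?_
  · intro i hi
    refine Finset.mem_filter.2 ⟨hv i hi, ⟨a i, ?_, h2 i hi⟩, ?_⟩
    · have hik := Finset.mem_range.1 (Finset.mem_filter.1 hi).1
      rw [hl i hi, List.mem_take_iff_getElem]
      exact ⟨i, by simp [hA i hi, hik], by simp [hA i hi]⟩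
    · obtain ⟨c, hc, hvc⟩ := h3 i hi
      exact ⟨c, hc, hvc.symm⟩
  · have key : ∀ i ∈ (Finset.range k).filter fun i => HasLongChord G W i k l,
        ∀ j ∈ (Finset.range k).filter fun i => HasLongChord G W i k l, i < j → v i ≠ v j := by
      intro i hi j hj hij he
      refine h1 j hj (a i) ?_ (he ▸ h2 i hi)
      have e : A j = l.take j := by
        conv_rhs => rw [hl j hj]
        rw [List.take_left' (hA j hj)]
      rw [e, hl i hi, List.mem_take_iff_getElem]
      exact ⟨i, by simp [hA i hi, hij], by simp [hA i hi]⟩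
    intro i hi j hj he
    rcases lt_trichotomy i j with h | h | h
    · exact absurd he (key i hi j hj h)
    · exact h
    · exact absurd he.symm (key j hj i hi h)

/-- Equidistribution: every node at the same depth carries the same share of the paths up to one
percent. This is what allows paths through different prefixes to be compared. -/
theorem TernaryTree.card_prefix_bounds (hT : TernaryTree G w W x M) {A : List V} {a : V}
    (h : IsPre G W x (A ++ [a])) (hA : A.length ≤ M) :
    0.99 * ((indPaths G w W x).card : ℝ) ≤
        3 ^ A.length * (((indPaths G w W x).filter fun l => A ++ [a] <+: l).card : ℝ) ∧
      3 ^ A.length * (((indPaths G w W x).filter fun l => A ++ [a] <+: l).card : ℝ) ≤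
        1.01 * ((indPaths G w W x).card : ℝ) := by
  have h1 := card_filter_prefix (G := G) (w := w) hT.notMem h
  have e : ((indPaths G w W x).filter fun l => A ++ [a] <+: l).card =
      (indPaths G w (rem G W A) a).card := h1
  rw [e, card_eq_ratio_mul (W := W), card_eq_ratio_mul (W := rem G W A)]
  have h2 := hT.card_rem h hA
  have h3 : cbrt3 ^ W.card = cbrt3 ^ (rem G W A).card * 3 ^ A.length := by
    rw [← h2, pow_add, pow_mul, cbrt3_pow_three]
  have h4 := hT.le_ratio h hA
  have h5 := hT.ratio_le h hA
  have h6 : (0 : ℝ) < cbrt3 ^ (rem G W A).card * 3 ^ A.length :=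
    mul_pos (pow_pos cbrt3_pos _) (by positivity)
  have h7 := mul_le_mul_of_nonneg_right h4 h6.le
  have h8 := mul_le_mul_of_nonneg_right h5 h6.le
  rw [h3]
  constructor <;> linarith

theorem TernaryTree.card_pos (hT : TernaryTree G w W x M) :
    (0 : ℝ) < ((indPaths G w W x).card : ℝ) := by
  rw [card_eq_ratio_mul]
  exact mul_pos hT.pos (pow_pos cbrt3_pos _)

/-- A vertex sequence in the tree has at most `2 * 3 ^ q` continuations by `q` vertices. -/
theorem TernaryTree.card_extensions_le (hT : TernaryTree G w W x M) {B : List V} {i q : ℕ}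
    (hB : B.length = i + 1) (hiq : i + q ≤ M) :
    (((indPaths G w W x).image (List.take (i + 1 + q))).filter fun P => B <+: P).card ≤
      2 * 3 ^ q := by
  set t := ((indPaths G w W x).image (List.take (i + 1 + q))).filter fun P => B <+: P with ht
  rcases Finset.eq_empty_or_nonempty t with h | ⟨P₀, hP₀⟩
  · rw [h]; simp
  have hpos := hT.card_pos
  have snoc : ∀ {P : List V} {k : ℕ}, P.length = k + 1 → ∃ A a, P = A ++ [a] ∧ A.length = k := by
    intro P k hP
    rcases P.eq_nil_or_concat with rfl | ⟨A, a, rfl⟩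
    · simp at hP
    · exact ⟨A, a, List.concat_eq_append, by simpa using hP⟩
  have hmem : ∀ P ∈ t, IsPre G W x P ∧ P.length = i + q + 1 ∧ B <+: P := by
    intro P hP
    obtain ⟨hP, hBP⟩ := Finset.mem_filter.1 hP
    obtain ⟨l, hl, rfl⟩ := Finset.mem_image.1 hP
    have h1 := hT.lt_length hl
    refine ⟨IsPre.of_append (B := l.drop (i + 1 + q)) ?_ ?_, by simp; omega, hBP⟩
    · intro h; have := congrArg List.length h; rw [List.length_take, List.length_nil] at this; omega
    · rw [List.take_append_drop]; exact (mem_indPaths.1 hl).1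
  have hBpre : IsPre G W x B := by
    obtain ⟨h1, -, R, rfl⟩ := hmem P₀ hP₀
    exact h1.of_append (by intro h; simp [h] at hB)
  obtain ⟨A, a, rfl, hA⟩ := snoc hB
  have hup := (hT.card_prefix_bounds hBpre (by omega)).2
  rw [hA] at hup
  have hsum : ∑ P ∈ t, ((indPaths G w W x).filter fun l => P <+: l).card ≤
      ((indPaths G w W x).filter fun l => A ++ [a] <+: l).card := by
    rw [← Finset.card_biUnion]
    · refine Finset.card_le_card fun l hl => ?_
      obtain ⟨P, hP, hl⟩ := Finset.mem_biUnion.1 hl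
      obtain ⟨hl, hPl⟩ := Finset.mem_filter.1 hl
      exact Finset.mem_filter.2 ⟨hl, (hmem P hP).2.2.trans hPl⟩
    · intro P hP P' hP' hne
      rw [Function.onFun, Finset.disjoint_left]
      intro l h1 h2
      refine hne ?_
      rw [List.prefix_iff_eq_take.1 (Finset.mem_filter.1 h1).2,
        List.prefix_iff_eq_take.1 (Finset.mem_filter.1 h2).2, (hmem P hP).2.1, (hmem P' hP').2.1]
  have hlow : ∀ P ∈ t, 0.99 * ((indPaths G w W x).card : ℝ) / 3 ^ (i + q) ≤
      (((indPaths G w W x).filter fun l => P <+: l).card : ℝ) := by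
    intro P hP
    obtain ⟨h1, h2, -⟩ := hmem P hP
    obtain ⟨A', a', rfl, hA'⟩ := snoc h2
    have := (hT.card_prefix_bounds h1 (by omega)).1
    rw [hA'] at this
    rw [div_le_iff₀ (by positivity)]
    linarith
  have h5 := Finset.card_nsmul_le_sum _ _ _ hlow
  rw [nsmul_eq_mul] at h5
  have h6 : ∑ P ∈ t, (((indPaths G w W x).filter fun l => P <+: l).card : ℝ) ≤
      ((indPaths G w W x).filter fun l => A ++ [a] <+: l).card := by exact_mod_cast hsum
  have h7 := h5.trans h6
  have h8 : (0 : ℝ) < 3 ^ (i + q) := by positivity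
  have h9 : (t.card : ℝ) * (0.99 * ((indPaths G w W x).card : ℝ)) ≤
      3 ^ q * (1.01 * (indPaths G w W x).card) := by
    have h10 := mul_le_mul_of_nonneg_right h7 h8.le
    have h11 : (t.card : ℝ) * (0.99 * ((indPaths G w W x).card : ℝ) / 3 ^ (i + q)) * 3 ^ (i + q) =
        t.card * (0.99 * ((indPaths G w W x).card : ℝ)) := by
      field_simp
    rw [h11, pow_add] at h10
    have h12 := mul_le_mul_of_nonneg_left hup (show (0 : ℝ) ≤ 3 ^ q by positivity)
    linarith
  have h13 : (t.card : ℝ) ≤ 2 * 3 ^ q := by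
    by_contra! hcon
    have h14 := mul_lt_mul_of_pos_right hcon (show 0 < 0.99 * ((indPaths G w W x).card : ℝ) by
      linarith)
    have h15 : (0 : ℝ) < 3 ^ q * ((indPaths G w W x).card : ℝ) := by positivity
    linarith
  exact_mod_cast h13

theorem TernaryTree.card_rem_add (hT : TernaryTree G w W x M) {A : List V} {a : V}
    (h : IsPre G W x (A ++ [a])) (hA : A.length ≤ M) :
    (rem G W (A ++ [a])).card + 3 * (A.length + 1) = W.card := by
  have h1 := hT.card_rem h hA
  have h2 := hT.card_nb h hA
  have h3 := _root_.card_rem_add (G := G) (W := rem G W A) (x := a)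
  rw [rem_append]
  omega

/-- Skipping the part of a path between the two ends of a chord leaves something unseen: the
shortened path has a straddling vertex on many of its continuations. -/
theorem TernaryTree.exists_prefix_of_hasShortChord (hT : TernaryTree G w W x M) {i q k : ℕ}
    {l : List V} (hl : l ∈ indPaths G w W x) (hs : HasShortChord G W i q l) (hiq : i + q + 1 ≤ M)
    (hk : k + q ≤ M + 2) :
    ∃ B : List V, B.length + q = M + 2 ∧ B.take (i + 1) = l.take (i + 1) ∧
      B.drop (i + 2) = (l.take (M + 1)).drop (i + 1 + q) ∧
      (((indPaths G w W x).filter fun l' => l.take (M + 1) <+: l').card : ℝ) ≤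
        4 * ((indPaths G w W x).filter fun l' => B <+: l' ∧ (HasLongChord G W i k l' ∨
          HasLongChord G W (i + 1) k l' ∨ HasLongChord G W (i + 2) k l')).card := by
  have hx := hT.notMem
  obtain ⟨A, a, Q, b, R, v, rfl, hA, hQ, hq, hv, hAv, hav, hvb, hRv⟩ := hs
  have hlen := hT.lt_length hl
  have hpre := (mem_indPaths.1 hl).1
  set R₁ := R.take (M - i - q - 1) with hR₁
  set R₂ := R.drop (M - i - q - 1) with hR₂
  have hR : R = R₁ ++ R₂ := (List.take_append_drop _ _).symm
  have hR₁l : R₁.length = M - i - q - 1 := by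
    rw [hR₁, List.length_take]
    simp at hlen
    omega
  clear_value R₁ R₂
  subst hR
  have hσ : (A ++ a :: (Q ++ b :: (R₁ ++ R₂))).take (M + 1) = A ++ a :: (Q ++ b :: R₁) := by
    rw [show A ++ a :: (Q ++ b :: (R₁ ++ R₂)) = (A ++ a :: (Q ++ b :: R₁)) ++ R₂ by simp]
    rw [List.take_left']
    simp; omega
  have hind := hpre.1
  have hnd := hind.nodup
  -- facts on adjacency along `l`
  have c1 := (isInd_append.1 hind)
  have c2 := isInd_append.1 (show IsInd G ([a] ++ (Q ++ b :: (R₁ ++ R₂))) from c1.2.1)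
  have c3 := isInd_append.1 c2.2.1
  have hQne : Q ≠ [] := by rintro rfl; simp at hQ; omega
  obtain ⟨q₀, Q', hQ'⟩ := List.exists_cons_of_ne_nil hQne
  have hAQ : ∀ c ∈ A, ∀ z ∈ Q, ¬ G.Adj c z := by
    intro c hc z hz hadj
    have := (c1.2.2 c hc z (by simp [hz])).2.1 hadj
    have e : a = z := by simpa using this.2
    exact (c2.2.2 a (by simp) z (by simp [hz])).1 e
  have hAtail : ∀ c ∈ A, ∀ z ∈ b :: (R₁ ++ R₂), ¬ G.Adj c z := by
    intro c hc z hz hadj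
    have := (c1.2.2 c hc z (by simp at hz ⊢; tauto)).2.1 hadj
    have e : a = z := by simpa using this.2
    exact (c2.2.2 a (by simp) z (List.mem_append_right _ hz)).1 e
  have hatail : ∀ z ∈ b :: (R₁ ++ R₂), ¬ G.Adj a z := by
    intro z hz hadj
    have := (c2.2.2 a (by simp) z (List.mem_append_right _ hz)).2.1 hadj
    have e : q₀ = z := by simpa [hQ'] using this.2
    exact (c3.2.2 q₀ (by simp [hQ']) z hz).1 e
  have hRQ : ∀ c ∈ R₁, ∀ z ∈ Q, ¬ G.Adj c z := by
    intro c hc z hz hadj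
    have := (c3.2.2 z hz c (by simp [hc])).2.1 hadj.symm
    have e : b = c := by simpa using this.2
    exact c3.2.1.1 (e ▸ List.mem_append_left _ hc)
  -- `v` is not on the shortened path
  have hvA : v ∉ A := by
    intro hvA
    obtain ⟨P, S, rfl⟩ := List.append_of_mem hvA
    rcases P.eq_nil_or_concat with rfl | ⟨P, p, rfl⟩
    · have : v = x := by simpa using hpre.2.1
      exact hx (this ▸ hv)
    · rw [List.concat_eq_append] at c1 hAv
      have h1 := (isInd_append.1 c1.1).2.2 p (by simp) v (by simp)
      exact hAv p (by simp) (h1.2.2 (by simp))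
  have hvR : v ∉ R₁ ++ R₂ := by
    intro h
    obtain ⟨P, S, hPS⟩ := List.append_of_mem h
    exact hatail v (by simp at h ⊢; tauto) hav
  have hva : v ≠ a := hav.ne'
  have hvbne : v ≠ b := hvb.ne
  -- the shortened path
  have hl'ind : IsInd G (A ++ a :: v :: b :: (R₁ ++ R₂)) := by
    refine isInd_append.2 ⟨c1.1, ⟨?_, ?_, ?_, ?_, c3.2.1⟩, ?_⟩
    · simp only [List.mem_cons, not_or]
      refine ⟨hva.symm, fun e => ?_, fun h => ?_⟩
      · exact (c2.2.2 a (by simp) b (by simp)).1 e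
      · exact (c2.2.2 a (by simp) a (by simp at h ⊢; tauto)).1 rfl
    · intro c hc
      rcases List.mem_cons.1 hc with rfl | hc
      · simpa using hav
      · have := hatail c hc
        have hne : v ≠ c := fun e => by
          rcases List.mem_cons.1 hc with h | h
          · exact hvbne (e.trans h)
          · exact hvR (e ▸ h)
        simp [this, hne]
    · simp only [List.mem_cons, not_or]
      exact ⟨hvbne, hvR⟩
    · intro c hc
      rcases List.mem_cons.1 hc with rfl | hc
      · simpa using hvb
      · have hne : b ≠ c := fun e => c3.2.1.1 (e ▸ hc)
        simp [hRv c hc, hne]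
    · intro c hc z hz
      rcases List.mem_cons.1 hz with rfl | hz
      · simpa using c1.2.2 c hc z (by simp)
      rcases List.mem_cons.1 hz with rfl | hz
      · refine ⟨fun e => hvA (e ▸ hc), ?_⟩
        simp [hAv c hc, hva.symm]
      · have h1 := c1.2.2 c hc z (by simp at hz ⊢; tauto)
        exact ⟨h1.1, by
          have := hAtail c hc z hz
          have hne : a ≠ z := fun e =>
            (c2.2.2 a (by simp) z (List.mem_append_right _ hz)).1 e
          simp [this, hne]⟩
  have hl'pre : IsPre G W x (A ++ a :: v :: b :: (R₁ ++ R₂)) := by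
    refine ⟨hl'ind, ?_, fun c hc => ?_⟩
    · have := hpre.2.1
      rcases A with _ | ⟨a', A⟩ <;> simpa using this
    · by_cases hcv : c = v
      · exact hcv ▸ hv
      · refine hpre.2.2 c ?_
        rcases A with _ | ⟨a', A⟩
        · simp [hcv] at hc ⊢; tauto
        · simp [hcv] at hc ⊢; tauto
  set B := A ++ a :: v :: b :: R₁ with hBdef
  have hBlen : B.length + q = M + 2 := by simp [hBdef]; omega
  have hBpre : IsPre G W x B := IsPre.of_append (B := R₂) (by simp [hBdef]) (by simpa [hBdef] using hl'pre)
  have hσpre : IsPre G W x (A ++ a :: (Q ++ b :: R₁)) :=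
    IsPre.of_append (B := R₂) (by simp) (by simpa using hpre)
  obtain ⟨B', b', hB'⟩ : ∃ B' b', B = B' ++ [b'] := by
    rcases B.eq_nil_or_concat with h | ⟨B', b', h⟩
    · simp [hBdef] at h
    · exact ⟨B', b', by rw [h, List.concat_eq_append]⟩
  obtain ⟨σ', s', hσ'⟩ : ∃ σ' s', A ++ a :: (Q ++ b :: R₁) = σ' ++ [s'] := by
    rcases (A ++ a :: (Q ++ b :: R₁)).eq_nil_or_concat with h | ⟨B', b', h⟩
    · simp at h
    · exact ⟨B', b', by rw [h, List.concat_eq_append]⟩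
  have hσlen : σ'.length = M := by
    have := congrArg List.length hσ'
    simp at this; omega
  have hB'len : B'.length + q = M + 1 := by
    have := congrArg List.length hB'
    simp at this; omega
  -- Each prefix sees exactly three vertices per step. The shortcut saves `q - 1 ≥ 1` vertices, so
  -- `B` leaves strictly more of `W` unseen than the original prefix.
  have hcσ := hT.card_rem_add (hσ' ▸ hσpre) (by omega)
  have hcB := hT.card_rem_add (hB' ▸ hBpre) (by omega)
  rw [← hσ'] at hcσ
  rw [← hB'] at hcB
  -- a vertex that only the skipped part sees
  obtain ⟨u, hu, hu'⟩ : ∃ u ∈ rem G W B, u ∉ rem G W (A ++ a :: (Q ++ b :: R₁)) := by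
    by_contra! hcon
    have := Finset.card_le_card hcon
    omega
  obtain ⟨huW, huB⟩ := mem_rem.1 hu
  obtain ⟨e, heQ, heu⟩ : ∃ e ∈ Q, G.Adj e u := by
    by_contra! hcon
    refine hu' (mem_rem.2 ⟨huW, fun c hc => ?_⟩)
    by_cases hcQ : c ∈ Q
    · exact hcon c hcQ
    · refine huB c ?_
      simp [hBdef] at hc ⊢; tauto
  have hQW : ∀ z ∈ Q, z ∈ W := by
    intro z hz
    refine hpre.2.2 z ?_
    rcases A with _ | ⟨a', A⟩ <;> simp [hz]
  -- A skipped vertex `z` that `B` sees, with a neighbour `z'` that `B` does not see. If `B` sees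
  -- all of `Q`, the pair is `e`, `u`. Otherwise `z'` is the first unseen vertex of `Q` and `z` its
  -- predecessor, which exists because the first vertex of `Q` is adjacent to `a`.
  obtain ⟨z, hzQ, hzB, z', hz'B, hzz'⟩ : ∃ z ∈ Q, z ∉ rem G W B ∧ ∃ z' ∈ rem G W B, G.Adj z z' := by
    by_cases hall : ∃ z ∈ Q, z ∈ rem G W B
    · obtain ⟨P, z', S, hPS, hz', hP⟩ := List.exists_first_split hall
      rcases P.eq_nil_or_concat with rfl | ⟨P, z, rfl⟩
      · exfalso
        have e1 : Q.head? = some z' := by rw [hPS]; rfl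
        have h1 := (c2.2.2 a (by simp) z' (by rw [hPS]; simp)).2.2 (by simp [e1])
        exact (mem_rem.1 hz').2 a (by simp [hBdef]) h1
      · rw [List.concat_eq_append] at hPS hP
        refine ⟨z, by simp [hPS], hP z (by simp), z', hz', ?_⟩
        have h1 := c3.1
        rw [hPS] at h1
        exact ((isInd_append.1 h1).2.2 z (by simp) z' (by simp)).2.2 (by simp)
    · push Not at hall
      exact ⟨e, heQ, hall e heQ, u, hu, heu⟩
  have hzW := hQW z hzQ
  obtain ⟨f, hfB, hfz⟩ : ∃ f ∈ B, G.Adj f z := by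
    by_contra! hcon
    exact hzB (mem_rem.2 ⟨hzW, hcon⟩)
  have hz'B' : z' ∈ rem G W B' := by
    rw [hB', rem_append] at hz'B
    exact rem_subset hz'B
  have hlong : ∀ T, b' :: T ∈ indPaths G w (rem G W B') b' → z' ∈ T →
      HasLongChord G W i k (B' ++ b' :: T) ∨ HasLongChord G W (i + 1) k (B' ++ b' :: T) ∨
        HasLongChord G W (i + 2) k (B' ++ b' :: T) := by
    intro T _ hz'T
    have e1 : B' ++ b' :: T = B ++ T := by simp [hB']
    have hdrop : ∃ c ∈ (B ++ T).drop k, G.Adj z c := by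
      refine ⟨z', ?_, hzz'⟩
      rw [List.drop_append_of_le_length (by omega)]
      exact List.mem_append_right _ hz'T
    rw [e1]
    -- The parts `A` and `R₁` have no neighbours in `Q`, so the first neighbour of `z` on the
    -- shortened path is `a`, `v` or `b`, at position `i`, `i + 1` or `i + 2`.
    by_cases haz : G.Adj a z
    · exact .inl ⟨A, a, v :: b :: (R₁ ++ T), z, by simp [hBdef], hA, hzW,
        fun c hc => hAQ c hc z hzQ, haz, hdrop⟩
    by_cases hvz : G.Adj v z
    · refine .inr (.inl ⟨A ++ [a], v, b :: (R₁ ++ T), z, by simp [hBdef], by simp [hA], hzW,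
        fun c hc => ?_, hvz, hdrop⟩)
      rcases List.mem_append.1 hc with hc | hc
      · exact hAQ c hc z hzQ
      · obtain rfl : c = a := by simpa using hc
        exact haz
    refine .inr (.inr ⟨A ++ [a, v], b, R₁ ++ T, z, by simp [hBdef], by simp [hA], hzW,
        fun c hc => ?_, ?_, hdrop⟩)
    · simp only [List.mem_append, List.mem_cons, List.not_mem_nil, or_false] at hc
      rcases hc with hc | rfl | rfl
      · exact hAQ c hc z hzQ
      · exact haz
      · exact hvz
    · simp only [hBdef, List.mem_append, List.mem_cons] at hfB
      rcases hfB with hf | rfl | rfl | rfl | hf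
      · exact absurd hfz (hAQ f hf z hzQ)
      · exact absurd hfz haz
      · exact absurd hfz hvz
      · exact hfz
      · exact absurd hfz (hRQ f hf z hzQ)
  have hhit := hT.le_card_filter (hB' ▸ hBpre) (by omega) hz'B'
    (fun l' => HasLongChord G W i k l' ∨ HasLongChord G W (i + 1) k l' ∨
      HasLongChord G W (i + 2) k l') hlong
  have hb1 := (hT.card_prefix_bounds (hσ' ▸ hσpre) (by omega)).2
  have hb2 := (hT.card_prefix_bounds (hB' ▸ hBpre) (by omega)).1
  rw [← hB'] at hhit hb2
  rw [← hσ', hσlen] at hb1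
  refine ⟨B, hBlen, ?_, ?_, ?_⟩
  · rw [hBdef, show A ++ a :: v :: b :: R₁ = (A ++ [a]) ++ v :: b :: R₁ by simp,
      show A ++ a :: (Q ++ b :: (R₁ ++ R₂)) = (A ++ [a]) ++ (Q ++ b :: (R₁ ++ R₂)) by simp,
      List.take_left' (by simp [hA]), List.take_left' (by simp [hA])]
  · rw [hσ, hBdef, show A ++ a :: v :: b :: R₁ = (A ++ [a, v]) ++ b :: R₁ by simp,
      show A ++ a :: (Q ++ b :: R₁) = (A ++ [a] ++ Q) ++ b :: R₁ by simp,
      List.drop_left' (by simp [hA]), List.drop_left' (by simp [hA, hQ]; omega)]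
  · rw [hσ]
    have h3 : (3 : ℝ) ^ B'.length ≤ 3 ^ M := pow_le_pow_right₀ (by norm_num) (by omega)
    have h4 : (0 : ℝ) < 3 ^ M := by positivity
    have h5 := mul_le_mul_of_nonneg_right h3
      (Nat.cast_nonneg (α := ℝ) ((indPaths G w W x).filter fun l' => B <+: l').card)
    have h6 : (3 : ℝ) ^ M *
        (((indPaths G w W x).filter fun l' => A ++ a :: (Q ++ b :: R₁) <+: l').card : ℝ) ≤
        3 ^ M * (1.1 * (((indPaths G w W x).filter fun l' => B <+: l').card : ℝ)) := by
      linarith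
    have h7 := le_of_mul_le_mul_left h6 h4
    have h8 : (0 : ℝ) ≤ (((indPaths G w W x).filter fun l' => B <+: l').card : ℝ) :=
      Nat.cast_nonneg _
    linarith

end Chords

/-! ### Homogeneity of the root by comparing the chord counts -/

section Homogeneity

open scoped Classical

variable {V : Type*} {G : SimpleGraph V}
  [Fintype V] {w x : V} {W : Finset V} {M : ℕ}

/-- Double counting over prefixes `σ` with a short chord and their shortcuts `B σ`. The shortcut
costs a factor 4, and at most `2 * 3 ^ q` prefixes share a shortcut. -/
theorem TernaryTree.card_hasShortChord_le (hT : TernaryTree G w W x M) {i q k : ℕ}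
    (hiq : i + q + 1 ≤ M) (hk : k + q ≤ M + 2) :
    (((indPaths G w W x).filter fun l => HasShortChord G W i q l).card : ℝ) ≤
      8 * 3 ^ q * ((indPaths G w W x).filter fun l => HasLongChord G W i k l ∨
          HasLongChord G W (i + 1) k l ∨ HasLongChord G W (i + 2) k l).card := by
  set S := (indPaths G w W x).filter fun l => HasShortChord G W i q l with hS
  set t := S.image (List.take (M + 1)) with ht
  set Lg := (indPaths G w W x).filter fun l => HasLongChord G W i k l ∨
          HasLongChord G W (i + 1) k l ∨ HasLongChord G W (i + 2) k l with hLg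
  have hch : ∀ σ ∈ t, ∃ B : List V, B.length + q = M + 2 ∧ B.take (i + 1) = σ.take (i + 1) ∧
      B.drop (i + 2) = σ.drop (i + 1 + q) ∧
      (((indPaths G w W x).filter fun l' => σ <+: l').card : ℝ) ≤
        4 * (Lg.filter fun l' => B <+: l').card := by
    intro σ hσ
    obtain ⟨l, hl, rfl⟩ := Finset.mem_image.1 hσ
    obtain ⟨hl, hs⟩ := Finset.mem_filter.1 hl
    obtain ⟨B, h1, h2, h3, h4⟩ := hT.exists_prefix_of_hasShortChord hl hs hiq hk
    refine ⟨B, h1, ?_, h3, h4.trans (le_of_eq ?_)⟩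
    · rw [h2, List.take_take, min_eq_left (by omega)]
    · rw [hLg, Finset.filter_filter]
      congr 3
      ext l'
      simp only [Finset.mem_filter]
      tauto
  choose! B hB1 hB2 hB3 hB4 using hch
  have h1 : (S.card : ℝ) ≤ ∑ σ ∈ t, (((indPaths G w W x).filter fun l' => σ <+: l').card : ℝ) := by
    rw [Finset.card_eq_sum_card_fiberwise (f := List.take (M + 1)) (t := t)
      (fun l hl => Finset.mem_image_of_mem _ hl)]
    push_cast
    refine Finset.sum_le_sum fun σ _ => Nat.cast_le.2 (Finset.card_le_card fun l hl => ?_)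
    obtain ⟨hlS, hσ⟩ := Finset.mem_filter.1 hl
    exact Finset.mem_filter.2 ⟨(Finset.mem_filter.1 hlS).1, hσ ▸ List.take_prefix _ _⟩
  have h2 : ∑ σ ∈ t, (Lg.filter fun l' => B σ <+: l').card =
      ∑ l' ∈ Lg, (t.filter fun σ => B σ <+: l').card :=
    Finset.sum_card_bipartiteAbove_eq_sum_card_bipartiteBelow (fun σ l' => B σ <+: l')
  have h3 : ∀ l' ∈ Lg, (t.filter fun σ => B σ <+: l').card ≤ 2 * 3 ^ q := by
    intro l' hl'
    have hlen := hT.lt_length (Finset.mem_filter.1 hl').1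
    -- The shortcut keeps the first `i + 1` entries of `σ` and everything from position `i + 1 + q`
    -- on; only the `q` skipped entries are free.
    refine le_trans (Finset.card_le_card_of_injOn (List.take (i + 1 + q)) ?_ ?_)
      (hT.card_extensions_le (B := l'.take (i + 1)) (i := i) (q := q) (by simp; omega) (by omega))
    · intro σ hσ
      obtain ⟨hσ, hpre⟩ := Finset.mem_filter.1 hσ
      have hb := hB2 σ hσ
      have hbl := hB1 σ hσ
      rw [List.prefix_iff_eq_take.1 hpre, List.take_take, min_eq_left (by omega)] at hb
      obtain ⟨l, hl, rfl⟩ := Finset.mem_image.1 hσ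
      refine Finset.mem_filter.2 ⟨Finset.mem_image.2 ⟨l, (Finset.mem_filter.1 hl).1, ?_⟩, ?_⟩
      · rw [List.take_take, min_eq_left (by omega)]
      · rw [hb]
        exact List.take_prefix_take_left (by omega)
    · intro σ hσ σ' hσ' he
      obtain ⟨hσ, hpre⟩ := Finset.mem_filter.1 hσ
      obtain ⟨hσ', hpre'⟩ := Finset.mem_filter.1 hσ'
      have e : B σ = B σ' := by
        rw [List.prefix_iff_eq_take.1 hpre, List.prefix_iff_eq_take.1 hpre']
        congr 1
        have := hB1 σ hσ
        have := hB1 σ' hσ'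
        omega
      rw [← List.take_append_drop (i + 1 + q) σ, ← List.take_append_drop (i + 1 + q) σ',
        ← hB3 σ hσ, ← hB3 σ' hσ', e]
      exact congrArg (· ++ _) he
  have h4 := Finset.sum_le_card_nsmul _ _ _ h3
  rw [← h2, smul_eq_mul] at h4
  have h5 : ∑ σ ∈ t, ((Lg.filter fun l' => B σ <+: l').card : ℝ) ≤ Lg.card * (2 * 3 ^ q) := by
    exact_mod_cast h4
  have h6 := Finset.sum_le_sum hB4
  rw [← Finset.mul_sum] at h6
  linarith

theorem sum_card_hasLongChord_le (hx : x ∉ W) (hxw : x ≠ w) (k : ℕ) :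
    ∑ i ∈ Finset.range k, (((indPaths G w W x).filter fun l => HasLongChord G W i k l).card : ℝ) ≤
      138 * cbrt3 ^ W.card := by
  refine le_trans ?_ (sum_straddle_le (G := G) hx hxw k)
  have h : ∑ i ∈ Finset.range k, ((indPaths G w W x).filter fun l => HasLongChord G W i k l).card =
      ∑ l ∈ indPaths G w W x, ((Finset.range k).filter fun i => HasLongChord G W i k l).card :=
    Finset.sum_card_bipartiteAbove_eq_sum_card_bipartiteBelow (fun i l => HasLongChord G W i k l)
  have h' := h.trans_le (Finset.sum_le_sum fun l _ => card_hasLongChord_le (G := G) (W := W) k l)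
  exact_mod_cast h'

/-- The positions are cut into `N` blocks of length `L`, and "long" means reaching beyond the end of
the own block. Each block costs one application of the straddling bound, whatever its length. -/
theorem sum_card_hasLongChord_blocks_le (hx : x ∉ W) (hxw : x ≠ w) {L : ℕ} (N : ℕ) :
    ∑ i ∈ Finset.range (L * N),
      (((indPaths G w W x).filter fun l => HasLongChord G W i (L * (i / L + 1)) l).card : ℝ) ≤
        N * (138 * cbrt3 ^ W.card) := by
  induction N with
  | zero => simp
  | succ N ih =>
    have h := sum_card_hasLongChord_le (G := G) hx hxw (L * (N + 1))
    rw [Nat.mul_add, mul_one, Finset.sum_range_add] at h ⊢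
    have h1 : ∀ j ∈ Finset.range L, (((indPaths G w W x).filter fun l =>
        HasLongChord G W (L * N + j) (L * ((L * N + j) / L + 1)) l).card : ℝ) =
        (((indPaths G w W x).filter fun l =>
          HasLongChord G W (L * N + j) (L * N + L) l).card : ℝ) := by
      intro j hj
      have hj' := Finset.mem_range.1 hj
      have e : (L * N + j) / L = N := by
        rw [Nat.mul_add_div (by omega), Nat.div_eq_of_lt hj', add_zero]
      rw [e, Nat.mul_add, mul_one]
    rw [Finset.sum_congr rfl h1]
    have h2 : 0 ≤ ∑ i ∈ Finset.range (L * N), (((indPaths G w W x).filter fun l =>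
          HasLongChord G W i (L * N + L) l).card : ℝ) :=
      Finset.sum_nonneg fun _ _ => Nat.cast_nonneg _
    push_cast
    linarith

theorem sum_card_hasLongChord_shift_le (hx : x ∉ W) (hxw : x ≠ w) {N k j : ℕ} (h : N + j ≤ k) :
    ∑ i ∈ Finset.range N,
      (((indPaths G w W x).filter fun l => HasLongChord G W (i + j) k l).card : ℝ) ≤
        138 * cbrt3 ^ W.card := by
  refine le_trans ?_ (sum_card_hasLongChord_le (G := G) hx hxw k)
  rw [← Finset.sum_image (s := Finset.range N) (g := fun i => i + j) (f := fun i =>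
    (((indPaths G w W x).filter fun l => HasLongChord G W i k l).card : ℝ))
    (by intro a _ b _ h; simpa using h)]
  refine Finset.sum_le_sum_of_subset_of_nonneg ?_ fun _ _ _ => Nat.cast_nonneg _
  intro i hi
  obtain ⟨a, ha, rfl⟩ := Finset.mem_image.1 hi
  have := Finset.mem_range.1 ha
  exact Finset.mem_range.2 (by omega)

/-- If the root is not homogeneous, the first `L * N` positions carry at least `0.3 * L₁ * N` chords
per path on average, where `L = 2 * L₁`. Chords that leave their block account for at most `138 / ρ
* N`. The short ones turn into chords over the single place `k` beyond all blocks, so they account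
for a constant that does not depend on `N`. For suitable `L₁` and then `N` these bounds contradict
each other. -/
theorem exists_homogeneousAt {ρ : ℝ} (hρ : 0 < ρ) :
    ∃ M : ℕ, ∀ {V : Type*} [Fintype V] (G : SimpleGraph V) (w : V) (W : Finset V) (x : V),
      x ≠ w → ρ ≤ ratio G w W x → TernaryTree G w W x M → HomogeneousAt G W x := by
  -- The block length makes the linear term win by at least 1 per block.
  obtain ⟨L₁, hL₁⟩ := exists_nat_ge ((138 / ρ + 1) / 0.3)
  rw [div_le_iff₀ (by norm_num)] at hL₁
  set L := 2 * L₁ with hL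
  -- The number of blocks exceeds the total of the short chords: `L` values of `q`, the factor `8 *
  -- 3 ^ L`, and three starting positions.
  obtain ⟨N, hN⟩ := exists_nat_gt (138 / ρ * (24 * L * 3 ^ L))
  refine ⟨L * N + L + 10, ?_⟩
  intro V _ G w W x hxw hr hT
  by_contra hroot
  have hx := hT.notMem
  have hpos := hT.card_pos
  set P := indPaths G w W x with hP
  set k := L * N + 12 with hk
  have h1 := hT.le_sum_card_hasChord hroot (H := L₁ * N)
    (by have : 2 * (L₁ * N) = L * N := by rw [hL]; ring
        omega)
  rw [show 2 * (L₁ * N) = L * N by rw [hL]; ring, ← hP] at h1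
  have h2 : ∀ i ∈ Finset.range (L * N), ((P.filter fun l => HasChord G W i l).card : ℝ) ≤
      ((P.filter fun l => HasLongChord G W i (L * (i / L + 1)) l).card : ℝ) +
        L * (8 * 3 ^ L) * (((P.filter fun l => HasLongChord G W (i + 0) k l).card : ℝ) +
          ((P.filter fun l => HasLongChord G W (i + 1) k l).card : ℝ) +
          ((P.filter fun l => HasLongChord G W (i + 2) k l).card : ℝ)) := by
    intro i hi
    have hi' := Finset.mem_range.1 hi
    have hsub : P.filter (fun l => HasChord G W i l) ⊆
        P.filter (fun l => HasLongChord G W i (L * (i / L + 1)) l) ∪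
          (Finset.range L).biUnion fun q => P.filter fun l => HasShortChord G W i q l := by
      intro l hl
      obtain ⟨hl, hc⟩ := Finset.mem_filter.1 hl
      have hdm := Nat.div_add_mod i L
      rcases hc.long_or_short (k := L * (i / L + 1)) (L := L) (by rw [Nat.mul_add]; omega) with h | ⟨q, hq, h⟩
      · exact Finset.mem_union_left _ (Finset.mem_filter.2 ⟨hl, h⟩)
      · exact Finset.mem_union_right _ (Finset.mem_biUnion.2 ⟨q, hq, Finset.mem_filter.2 ⟨hl, h⟩⟩)
    have h3 : ((P.filter fun l => HasChord G W i l).card : ℝ) ≤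
        ((P.filter fun l => HasLongChord G W i (L * (i / L + 1)) l).card : ℝ) +
          ∑ q ∈ Finset.range L, ((P.filter fun l => HasShortChord G W i q l).card : ℝ) := by
      exact_mod_cast (Finset.card_le_card hsub).trans ((Finset.card_union_le _ _).trans
        (Nat.add_le_add_left Finset.card_biUnion_le _))
    have h4 : ∀ q ∈ Finset.range L, ((P.filter fun l => HasShortChord G W i q l).card : ℝ) ≤
        8 * 3 ^ L * (((P.filter fun l => HasLongChord G W (i + 0) k l).card : ℝ) +
          ((P.filter fun l => HasLongChord G W (i + 1) k l).card : ℝ) +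
          ((P.filter fun l => HasLongChord G W (i + 2) k l).card : ℝ)) := by
      intro q hq
      have hq' := Finset.mem_range.1 hq
      refine (hT.card_hasShortChord_le (i := i) (q := q) (k := k) (by omega) (by omega)).trans ?_
      refine mul_le_mul ?_ ?_ (Nat.cast_nonneg _) (by positivity)
      · exact mul_le_mul_of_nonneg_left (pow_le_pow_right₀ (by norm_num) hq'.le) (by norm_num)
      · rw [Finset.filter_or, Finset.filter_or, ← Nat.cast_add, ← Nat.cast_add, add_assoc]
        exact Nat.cast_le.2 ((Finset.card_union_le _ _).trans
          (Nat.add_le_add_left (Finset.card_union_le _ _) _))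
    have h5 := Finset.sum_le_card_nsmul _ _ _ h4
    rw [Finset.card_range, nsmul_eq_mul] at h5
    linarith
  have h3 := h1.trans (Finset.sum_le_sum h2)
  rw [Finset.sum_add_distrib, ← Finset.mul_sum, Finset.sum_add_distrib,
    Finset.sum_add_distrib] at h3
  have h4 := sum_card_hasLongChord_blocks_le (G := G) hx hxw (L := L) N
  have h5 := fun j (hj : j ≤ 2) =>
    sum_card_hasLongChord_shift_le (G := G) hx hxw (N := L * N) (k := k) (j := j) (by omega)
  have h6 := h5 0 (by norm_num)
  have h7 := h5 1 (by norm_num)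
  have h8 := h5 2 (by norm_num)
  rw [← hP] at h4 h6 h7 h8
  have h9 : cbrt3 ^ W.card ≤ (P.card : ℝ) / ρ := by
    rw [le_div_iff₀ hρ, hP, card_eq_ratio_mul, mul_comm]
    exact mul_le_mul_of_nonneg_right hr (pow_nonneg cbrt3_pos.le _)
  have h10 : 0.3 * (L₁ * N : ℕ) * (P.card : ℝ) ≤
      N * (138 * (P.card / ρ)) + L * (8 * 3 ^ L) * (3 * (138 * (P.card / ρ))) := by
    refine h3.trans (add_le_add (h4.trans ?_) (mul_le_mul_of_nonneg_left ?_ (by positivity)))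
    · exact mul_le_mul_of_nonneg_left (by linarith) (Nat.cast_nonneg _)
    · linarith
  have h11 : 0.3 * (L₁ * N : ℕ) * (P.card : ℝ) ≤
      (138 / ρ * N + 138 / ρ * (24 * L * 3 ^ L)) * P.card := by
    refine h10.trans (le_of_eq ?_)
    field_simp
    ring
  have h12 := le_of_mul_le_mul_right h11 hpos
  push_cast at h12
  have h13 : (138 / ρ + 1) * N ≤ L₁ * 0.3 * N :=
    mul_le_mul_of_nonneg_right hL₁ (Nat.cast_nonneg _)
  linarith

/-- The first step in an irreducible situation: the neighbours of the starting vertex form a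
cluster of size three. -/
theorem exists_cluster_of_pathIrreducible {ρ : ℝ} (hρ : 0 < ρ) :
    ∃ m : ℕ, ∃ δ : ℝ, 0 < δ ∧ ∀ {V : Type*} [Fintype V] (G : SimpleGraph V) (w : V) (W : Finset V)
      (x : V), x ∉ W → x ≠ w → ρ ≤ ratio G w W x → PathIrreducible G w W x m δ →
        (nb G W x).card = 3 ∧ HomogeneousAt G W x := by
  obtain ⟨M, hM⟩ := exists_homogeneousAt hρ
  obtain ⟨D, hD⟩ := exists_card_nb_le (half_pos hρ)
  refine ⟨3 * M + D + 3, 1 / 1000 / 4 ^ (M + 2), by positivity, ?_⟩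
  intro V _ G w W x hx hxw hr hirr
  have hT := hirr.ternaryTree (M := M) (D := D) hx hxw (hρ.trans_le hr) (by positivity)
    (le_of_eq (mul_div_cancel₀ _ (by positivity))) le_rfl
    (fun W' x' hx' hx'w h => hD G w W' x' hx' hx'w (by linarith))
  refine ⟨?_, hM G w W x hxw hr hT⟩
  have := hT.card_nb (A := []) (a := x) isPre_singleton (Nat.zero_le _)
  rwa [rem_nil] at this

end Homogeneity

/-! ### Peeling off clusters -/

section ClusterChain

open scoped Classical

/-- Outside the set `S`, the list `L` of three-element clusters exhausts `W`, consecutive clusters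
are completely joined, other pairs are not joined, and the vertices of `Q` are joined to exactly
the first cluster. -/
def IsClusterChain {V : Type*} (G : SimpleGraph V) (S : Finset V) :
    Finset V → Finset V → List (Finset V) → Prop
  | W, _, [] => W ⊆ S
  | W, Q, B :: L => B ⊆ W ∧ B.card = 3 ∧
      (∀ a ∈ Q, a ∉ S → ∀ b ∈ W, b ∉ S → (G.Adj a b ↔ b ∈ B)) ∧ IsClusterChain G S (W \ B) B L

theorem IsClusterChain.mono {V : Type*} {G : SimpleGraph V} {S S' W W' Q : Finset V}
    {L : List (Finset V)} (h : IsClusterChain G S W Q L) (hS : S ⊆ S') (hW : W ⊆ W')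
    (hWS : ∀ v ∈ W', v ∉ S' → v ∈ W) : IsClusterChain G S' W' Q L := by
  induction L generalizing W W' Q with
  | nil =>
    intro v hv
    by_contra hvS
    exact hvS (hS (h (hWS v hv hvS)))
  | cons B L ih =>
    obtain ⟨h1, h2, h3, h4⟩ := h
    refine ⟨h1.trans hW, h2, fun a ha haS b hb hbS => h3 a ha (fun h => haS (hS h)) b
      (hWS b hb hbS) fun h => hbS (hS h),
      ih h4 (Finset.sdiff_subset_sdiff hW subset_rfl) ?_⟩
    intro v hv hvS
    simp only [Finset.mem_sdiff] at hv ⊢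
    exact ⟨hWS v hv.1 hvS, hv.2⟩

/-- Either a cluster splits off and the ratio does not drop, or boundedly many vertices are
sacrificed and the ratio gains a factor 1 + δ. The second can happen at most `J` times because the
ratio stays between ρ and 1. The induction is on the number `j` of gains still possible and, inside,
on |W|. -/
theorem exists_isClusterChain {ρ : ℝ} (hρ : 0 < ρ) :
    ∃ C : ℕ, ∀ {V : Type*} [Fintype V] (G : SimpleGraph V) (w : V) (W : Finset V) (x : V),
      x ∉ W → ρ ≤ ratio G w W x →
        ∃ S ⊆ W, ∃ L, S.card ≤ C ∧ IsClusterChain G S W {x} L := by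
  obtain ⟨m, δ, hδ, hmain⟩ := exists_cluster_of_pathIrreducible hρ
  obtain ⟨D, hD⟩ := exists_card_nb_le hρ
  obtain ⟨c₀, hc₀⟩ := pow_unbounded_of_one_lt (1 / ρ) one_lt_cbrt3
  obtain ⟨J, hJ⟩ := pow_unbounded_of_one_lt (1 / ρ) (show 1 < 1 + δ by linarith)
  -- At most `c₀` vertices remain when the path has arrived at `w`. Each gain costs the `m` deleted
  -- vertices, the at most `D` neighbours of the old start, and the first cluster of the chain from
  -- the new start.
  refine ⟨c₀ + J * (m + D + 3), ?_⟩
  intro V _ G w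
  suffices key : ∀ j : ℕ, ∀ n : ℕ, ∀ (W : Finset V) (x : V), W.card = n → x ∉ W →
      ρ ≤ ratio G w W x → 1 ≤ ratio G w W x * (1 + δ) ^ j →
        ∃ S ⊆ W, ∃ L, S.card ≤ c₀ + j * (m + D + 3) ∧ IsClusterChain G S W {x} L by
    intro W x hx hr
    refine key J _ W x rfl hx hr ?_
    have h1 := mul_le_mul hr hJ.le (by positivity) ratio_nonneg
    rwa [mul_one_div_cancel hρ.ne'] at h1
  intro j
  induction j using Nat.strong_induction_on with
  | _ j ihj =>
  intro n
  induction n using Nat.strong_induction_on with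
  | _ n ihn =>
  intro W x hn hx hr hj
  by_cases hxw : x = w
  · subst hxw
    refine ⟨W, subset_rfl, [], ?_, subset_rfl⟩
    have h1 : W.card ≤ c₀ := by
      by_contra! hcon
      rw [ratio, indPaths_self hx, Finset.card_singleton, Nat.cast_one,
        le_one_div hρ (pow_pos cbrt3_pos _)] at hr
      have := pow_le_pow_right₀ one_lt_cbrt3.le hcon.le
      linarith
    omega
  by_cases hirr : PathIrreducible G w W x m δ
  · obtain ⟨h3, hhom⟩ := hmain G w W x hx hxw hr hirr
    obtain ⟨v, hv, hvr⟩ := exists_ratio_le hx hxw (hρ.trans_le hr)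
    rw [h3] at hvr
    simp only [le_refl, Nat.sub_eq_zero_of_le, add_zero, pow_zero, mul_one] at hvr
    have hc := card_rem_add (G := G) (W := W) (x := x)
    obtain ⟨S, hS, L, hSc, hL⟩ := ihn (rem G W [x]).card (by omega) (rem G W [x]) v rfl
      (notMem_rem_of_mem_nb hv) (hr.trans hvr)
      (hj.trans (mul_le_mul_of_nonneg_right hvr (by positivity)))
    refine ⟨S, hS.trans rem_subset, nb G W x :: L, hSc, Finset.filter_subset _ _, h3, ?_, ?_⟩
    · intro a ha _ b hb _
      obtain rfl : a = x := by simpa using ha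
      simp [mem_nb, hb]
    · rw [sdiff_nb]
      rcases L with _ | ⟨B, L⟩
      · exact hL
      · obtain ⟨h4, h5, h6, h7⟩ := hL
        -- The chain obtained for one vertex `v` of the new cluster is valid for the whole cluster,
        -- since all its vertices have the same neighbours further on.
        refine ⟨h4, h5, fun a ha _ b hb hbS => ?_, h7⟩
        rw [← h6 v (by simp) (fun h => notMem_rem_of_mem_nb hv (hS h)) b hb hbS]
        have := hhom a ha v hv
        rw [Finset.ext_iff] at this
        simpa [mem_nb, hb] using this b
  · simp only [PathIrreducible, not_forall, not_le] at hirr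
    obtain ⟨W', hW', x', hx', hc, hr'⟩ := hirr
    rcases j with _ | j
    · exfalso
      have h1 := ratio_le_one (G := G) (w := w) hx'
      rw [pow_zero, mul_one] at hj
      nlinarith
    · have hr0 := hρ.trans_le hr
      have hle : ratio G w W x ≤ (1 + δ) * ratio G w W x := by nlinarith
      obtain ⟨S, hS, L, hSc, hL⟩ := ihj j (Nat.lt_succ_self j) _ W' x' rfl hx'
        (hr.trans (hle.trans hr'.le)) (by
          refine hj.trans ?_
          rw [pow_succ, ← mul_assoc, mul_right_comm, mul_comm (ratio G w W x)]
          exact mul_le_mul_of_nonneg_right hr'.le (by positivity))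
      have hd := hD G w W x hx hxw hr
      have hsd := Finset.card_sdiff_add_card_eq_card hW'
      have hnbW : nb G W x ⊆ W := Finset.filter_subset _ _
      rcases L with _ | ⟨B, L⟩
      · refine ⟨S ∪ W \ W', Finset.union_subset (hS.trans hW') Finset.sdiff_subset, [], ?_, ?_⟩
        · have := Finset.card_union_le S (W \ W')
          rw [Nat.succ_mul]
          omega
        · intro v hv
          by_cases h : v ∈ W'
          · exact Finset.mem_union_left _ (hL h)
          · exact Finset.mem_union_right _ (Finset.mem_sdiff.2 ⟨hv, h⟩)
      · obtain ⟨h4, h5, h6, h7⟩ := hL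
        -- The new start need not be related to `x`. With the neighbours of `x` and the whole
        -- cluster `B` exceptional, the joining condition between them is void.
        refine ⟨S ∪ (W \ W') ∪ (nb G W x ∪ B), ?_, B :: L, ?_, h4.trans hW', h5, ?_, ?_⟩
        · exact Finset.union_subset
            (Finset.union_subset (hS.trans hW') Finset.sdiff_subset)
            (Finset.union_subset hnbW (h4.trans hW'))
        · have := Finset.card_union_le S (W \ W')
          have := Finset.card_union_le (nb G W x) B
          have := Finset.card_union_le (S ∪ W \ W') (nb G W x ∪ B)
          rw [Nat.succ_mul]
          omega
        · intro a ha _ b hb hbS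
          obtain rfl : a = x := by simpa using ha
          simp only [Finset.mem_union, not_or] at hbS
          have h8 : ¬ G.Adj a b := fun h => hbS.2.1 (mem_nb.2 ⟨hb, h⟩)
          simp [h8, hbS.2.2]
        · refine h7.mono (fun v hv => by simp [hv]) (Finset.sdiff_subset_sdiff hW' subset_rfl) ?_
          intro v hv hvS
          simp only [Finset.mem_sdiff, Finset.mem_union] at hv hvS ⊢
          tauto

end ClusterChain

/-! ### From induced cycles to induced paths -/

theorem IsInducedCycle.exists_param {V : Type*} {G : SimpleGraph V} {S : Finset V}
    (hS : IsInducedCycle G S) {v : V} (hv : v ∈ S) :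
    ∃ (m : ℕ) (h : ℕ → V), h 0 = v ∧
      (∀ i j, i < j → j < m + 3 → (G.Adj (h i) (h j) ↔ j = i + 1 ∨ (i = 0 ∧ j = m + 2))) ∧
      (∀ i < m + 3, ∀ j < m + 3, h i = h j → i = j) ∧ ∀ s, s ∈ S ↔ ∃ i < m + 3, h i = s := by
  obtain ⟨k, hk, ⟨φ⟩⟩ := hS
  obtain ⟨m, rfl⟩ := Nat.exists_eq_add_of_le' hk
  set i₀ := φ.symm ⟨v, hv⟩ with hi₀
  refine ⟨m, fun i => (φ (i₀ + Fin.ofNat (m + 3) i) : V), ?_, ?_, ?_, ?_⟩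
  · simp [hi₀]
  · intro i j hij hj
    have h1 : G.Adj (φ (i₀ + Fin.ofNat (m + 3) i) : V) (φ (i₀ + Fin.ofNat (m + 3) j) : V) ↔
        (SimpleGraph.cycleGraph (m + 3)).Adj (i₀ + Fin.ofNat (m + 3) i) (i₀ + Fin.ofNat (m + 3) j) := by
      rw [← φ.map_adj_iff]; rfl
    rw [h1, SimpleGraph.cycleGraph_adj, add_sub_add_left_eq_sub, add_sub_add_left_eq_sub,
      sub_eq_iff_eq_add, sub_eq_iff_eq_add]
    simp only [Fin.ext_iff, Fin.val_add, Fin.val_ofNat, Fin.val_one]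
    rw [Nat.mod_eq_of_lt hj, Nat.mod_eq_of_lt (hij.trans hj)]
    rcases Nat.lt_or_ge (1 + j) (m + 3) with h | h
    · rw [Nat.mod_eq_of_lt h, Nat.mod_eq_of_lt (by omega)]; omega
    · have : 1 + j = m + 3 := by omega
      rw [this, Nat.mod_self, Nat.mod_eq_of_lt (by omega)]; omega
  · intro i hi j hj h
    have h2 := φ.injective (Subtype.ext h)
    simpa [Fin.ext_iff, Fin.val_ofNat, Nat.mod_eq_of_lt hi, Nat.mod_eq_of_lt hj] using h2
  · intro s
    constructor
    · intro hs
      refine ⟨(φ.symm ⟨s, hs⟩ - i₀ : Fin (m + 3)).val, Fin.is_lt _, ?_⟩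
      simp
    · rintro ⟨i, -, rfl⟩
      exact (φ _).2

/-- Removing from an induced cycle a vertex leaves an induced path between its neighbours. -/
theorem IsInducedCycle.exists_indPath {V : Type*} [Fintype V] [DecidableEq V]
    {G : SimpleGraph V} [DecidableRel G.Adj] {S : Finset V}
    (hS : IsInducedCycle G S) {v : V} (hv : v ∈ S) :
    ∃ u ∈ S, ∃ w ∈ S, G.Adj v u ∧ G.Adj v w ∧ u ≠ w ∧
      ∃ l ∈ indPaths G w (insert w (S.filter fun z => z ≠ v ∧ ¬ G.Adj v z)) u,
        S = insert v l.toFinset := by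
  obtain ⟨m, h, h0, hadj, hinj, hmem⟩ := hS.exists_param hv
  have hS' : ∀ i < m + 3, h i ∈ S := fun i hi => (hmem _).2 ⟨i, hi, rfl⟩
  refine ⟨h 1, hS' 1 (by omega), h (m + 2), hS' _ (by omega), ?_, ?_, ?_,
    (List.range (m + 2)).map (fun j => h (j + 1)), mem_indPaths.2 ⟨⟨?_, ?_, ?_⟩, ?_⟩, ?_⟩
  · rw [← h0]; exact (hadj 0 1 (by omega) (by omega)).2 (.inl rfl)
  · rw [← h0]; exact (hadj 0 (m + 2) (by omega) (by omega)).2 (.inr ⟨rfl, rfl⟩)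
  · intro e
    have := hinj 1 (by omega) (m + 2) (by omega) e
    omega
  · refine isInd_of_getElem ?_ ?_
    · refine List.Nodup.map_on ?_ List.nodup_range
      intro i hi j hj e
      have := hinj (i + 1) (by simpa using hi) (j + 1) (by simpa using hj) e
      omega
    · intro i j hj hij
      rw [List.length_map, List.length_range] at hj
      simp only [List.getElem_map, List.getElem_range]
      rw [hadj (i + 1) (j + 1) (by omega) (by omega)]
      omega
  · simp [List.head?_map, List.head?_range]
  · intro c hc
    rw [← List.map_tail, List.mem_map] at hc
    obtain ⟨j, hj, rfl⟩ := hc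
    have hj' : 1 ≤ j ∧ j < m + 2 := by
      rw [List.range_succ_eq_map, List.tail_cons, List.mem_map] at hj
      obtain ⟨i, hi, rfl⟩ := hj
      have := List.mem_range.1 hi
      omega
    rw [Finset.mem_insert, Finset.mem_filter]
    by_cases hjm : j = m + 1
    · left; rw [hjm]
    · refine .inr ⟨hS' _ (by omega), fun e => ?_, fun e => ?_⟩
      · have := hinj (j + 1) (by omega) 0 (by omega) (e.trans h0.symm)
        omega
      · rw [← h0, hadj 0 (j + 1) (by omega) (by omega)] at e
        omega
  · rw [List.getLast?_map, List.getLast?_range]; simp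
  · ext s
    rw [hmem, Finset.mem_insert, List.mem_toFinset, List.mem_map]
    constructor
    · rintro ⟨i, hi, rfl⟩
      rcases i with _ | i
      · exact .inl h0
      · exact .inr ⟨i, List.mem_range.2 (by omega), rfl⟩
    · rintro (rfl | ⟨j, hj, rfl⟩)
      · exact ⟨0, by omega, h0⟩
      · exact ⟨j + 1, by have := List.mem_range.1 hj; omega, rfl⟩

section Cycles

open scoped Classical

theorem exists_sq_le_mul_pow {r : ℝ} (hr : 1 < r) :
    ∃ K : ℝ, 0 < K ∧ ∀ d : ℕ, (d : ℝ) ^ 2 ≤ K * r ^ d := by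
  have h0 : 0 < r := by linarith
  have h := tendsto_pow_const_mul_const_pow_of_abs_lt_one 2 (r := r⁻¹)
    (by rw [abs_of_pos (by positivity)]; exact inv_lt_one_of_one_lt₀ hr)
  obtain ⟨K, hK⟩ := h.bddAbove_range
  refine ⟨max K 1, by positivity, fun d => ?_⟩
  have h1 := hK ⟨d, rfl⟩
  simp only [inv_pow] at h1
  rw [← div_eq_mul_inv, div_le_iff₀ (by positivity)] at h1
  exact h1.trans (mul_le_mul_of_nonneg_right (le_max_left _ _) (by positivity))

/-- The neighbours of `v` that precede it. -/
noncomputable def lowerNb {n : ℕ} (F : SimpleGraph (Fin n)) (v : Fin n) : Finset (Fin n) :=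
  (Finset.Iio v).filter fun z => F.Adj v z

/-- The vertices that precede `v` and are not adjacent to it, and `w`. -/
noncomputable def lowerCoNb {n : ℕ} (F : SimpleGraph (Fin n)) (v w : Fin n) : Finset (Fin n) :=
  insert w ((Finset.Iio v).filter fun z => ¬ F.Adj v z)

theorem card_lowerCoNb {n : ℕ} {F : SimpleGraph (Fin n)} {v w : Fin n} (hw : w ∈ lowerNb F v) :
    (lowerCoNb F v w).card + (lowerNb F v).card = v + 1 := by
  have h1 := Finset.card_filter_add_card_filter_not (s := Finset.Iio v) (fun z => F.Adj v z)
  rw [Fin.card_Iio] at h1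
  have hw' := (Finset.mem_filter.1 hw).2
  rw [lowerCoNb, Finset.card_insert_of_notMem (by simp [hw']), lowerNb]
  omega

/-- A cycle is charged to its largest vertex `v` and to the path that remains without it. Summing
over largest vertices makes the final estimate a geometric series instead of costing a factor `n`.
-/
theorem numInducedCycles_le {n : ℕ} (F : SimpleGraph (Fin n)) :
    numInducedCycles F ≤ ∑ v : Fin n, ∑ p ∈ (lowerNb F v).offDiag,
      (indPaths F p.2 (lowerCoNb F v p.2) p.1).card := by
  have hsub : {S : Finset (Fin n) | IsInducedCycle F S} ⊆
      ((Finset.univ.biUnion fun v : Fin n => (lowerNb F v).offDiag.biUnion fun p =>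
        (indPaths F p.2 (lowerCoNb F v p.2) p.1).image fun l => insert v l.toFinset :
          Finset (Finset (Fin n))) : Set (Finset (Fin n))) := by
    intro S hS
    have hS' : IsInducedCycle F S := hS
    have hne : S.Nonempty := by
      obtain ⟨k, hk, ⟨φ⟩⟩ := hS'
      exact ⟨_, (φ ⟨0, by omega⟩).2⟩
    set v := S.max' hne with hv
    obtain ⟨u, hu, w, hw, hvu, hvw, huw, l, hl, hSl⟩ := hS'.exists_indPath (S.max'_mem hne)
    rw [← hv] at hvu hvw hl hSl
    have hlt : ∀ z ∈ S, z ≠ v → z < v := fun z hz hzv => lt_of_le_of_ne (S.le_max' z hz) hzv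
    simp only [Finset.coe_biUnion, Finset.coe_univ, Set.mem_univ, Set.iUnion_true, Set.mem_iUnion,
      Finset.mem_coe, Finset.mem_image, Finset.mem_offDiag]
    refine ⟨v, (u, w), ⟨?_, ?_, huw⟩, l, ?_, hSl.symm⟩
    · exact Finset.mem_filter.2 ⟨Finset.mem_Iio.2 (hlt u hu hvu.ne'), hvu⟩
    · exact Finset.mem_filter.2 ⟨Finset.mem_Iio.2 (hlt w hw hvw.ne'), hvw⟩
    · obtain ⟨⟨h1, h2, h3⟩, h4⟩ := mem_indPaths.1 hl
      refine mem_indPaths.2 ⟨⟨h1, h2, fun c hc => ?_⟩, h4⟩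
      have := h3 c hc
      rw [Finset.mem_insert, Finset.mem_filter] at this
      rw [lowerCoNb, Finset.mem_insert, Finset.mem_filter, Finset.mem_Iio]
      exact this.imp_right fun h => ⟨hlt c h.1 h.2.1, h.2.2⟩
  have h1 := Set.ncard_le_ncard hsub (Finset.finite_toSet _)
  rw [Set.ncard_coe_finset] at h1
  refine h1.trans (Finset.card_biUnion_le.trans (Finset.sum_le_sum fun v _ => ?_))
  exact Finset.card_biUnion_le.trans (Finset.sum_le_sum fun p _ => Finset.card_image_le)

/-- If every path count were below τ² c ^ n, then, combined with the general bound c ^ |W|, it would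
be below the geometric mean. That mean still decays exponentially in the degree of `v` and in `n -
v`, so the sum over all `v` and all pairs of neighbours is at most half of the given number of
cycles. -/
theorem exists_many_indPaths {α : ℝ} (hα : 0 < α) :
    ∃ ρ : ℝ, 0 < ρ ∧ ∀ (n : ℕ) (F : SimpleGraph (Fin n)),
      α * cbrt3 ^ n ≤ numInducedCycles F →
        ∃ (v u w : Fin n) (W : Finset (Fin n)), v ≠ u ∧ v ∉ W ∧ u ∉ W ∧
          ρ * cbrt3 ^ n ≤ ((indPaths F w W u).card : ℝ) := by
  set e := Real.sqrt cbrt3 with he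
  have he2 : e ^ 2 = cbrt3 := Real.sq_sqrt cbrt3_pos.le
  have he1 : 1 < e := by
    rw [he, Real.lt_sqrt (by norm_num)]; simpa using one_lt_cbrt3
  have he0 : 0 < e := by linarith
  obtain ⟨K, hK, hKd⟩ := exists_sq_le_mul_pow he1
  -- Chosen so that the geometric series, with ratio `e` = √c, sums to at most α / 2 * c ^ n.
  set τ := α * (e - 1) / (2 * K * e) with hτ
  have hτ0 : 0 < τ := div_pos (mul_pos hα (by linarith)) (by positivity)
  refine ⟨τ ^ 2, by positivity, fun n F hF => ?_⟩
  by_contra! hcon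
  have hpair : ∀ v : Fin n, ∀ p ∈ (lowerNb F v).offDiag,
      ((indPaths F p.2 (lowerCoNb F v p.2) p.1).card : ℝ) ≤
        τ * e ^ n * e ^ (lowerCoNb F v p.2).card := by
    rintro v ⟨u, w⟩ hp
    obtain ⟨hu, hw, huw⟩ := Finset.mem_offDiag.1 hp
    simp only at hu hw huw ⊢
    have hu' := Finset.mem_filter.1 hu
    have hw' := Finset.mem_filter.1 hw
    have huW : u ∉ lowerCoNb F v w := by simp [lowerCoNb, huw, hu'.2]
    have hvW : v ∉ lowerCoNb F v w := by simp [lowerCoNb, hw'.2.ne]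
    have h1 := (hcon v u w (lowerCoNb F v w) hu'.2.ne hvW huW).le
    have h2 := card_indPaths_le (G := F) (w := w) huW
    refine le_of_pow_le_pow_left₀ (n := 2) (by norm_num) (by positivity) ?_
    rw [pow_two, show (τ * e ^ n * e ^ (lowerCoNb F v w).card) ^ 2 =
      (τ ^ 2 * (e ^ 2) ^ n) * (e ^ 2) ^ (lowerCoNb F v w).card by ring, he2]
    exact mul_le_mul h1 h2 (Nat.cast_nonneg _)
      (mul_nonneg (by positivity) (pow_nonneg cbrt3_pos.le _))
  have hv : ∀ v : Fin n, ∑ p ∈ (lowerNb F v).offDiag,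
      ((indPaths F p.2 (lowerCoNb F v p.2) p.1).card : ℝ) ≤ τ * e ^ n * K * e * e ^ (v : ℕ) := by
    intro v
    set d := (lowerNb F v).card with hd
    have h1 : ∀ p ∈ (lowerNb F v).offDiag,
        ((indPaths F p.2 (lowerCoNb F v p.2) p.1).card : ℝ) ≤
          τ * e ^ n * (e ^ ((v : ℕ) + 1) / e ^ d) := by
      intro p hp
      refine (hpair v p hp).trans (le_of_eq ?_)
      rw [← card_lowerCoNb (Finset.mem_offDiag.1 hp).2.1, ← hd, pow_add,
        mul_div_cancel_right₀ _ (by positivity)]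
    have h2 := Finset.sum_le_card_nsmul _ _ _ h1
    rw [nsmul_eq_mul] at h2
    have h3 : (((lowerNb F v).offDiag.card : ℕ) : ℝ) ≤ K * e ^ d := by
      refine le_trans ?_ (hKd d)
      rw [Finset.offDiag_card, ← hd, pow_two]
      exact_mod_cast Nat.sub_le _ _
    refine (h2.trans (mul_le_mul_of_nonneg_right h3 (by positivity))).trans (le_of_eq ?_)
    rw [pow_succ]
    field_simp
  have hsum : (numInducedCycles F : ℝ) ≤ ∑ v : Fin n, τ * e ^ n * K * e * e ^ (v : ℕ) := by
    refine le_trans (Nat.cast_le.2 (numInducedCycles_le F)) ?_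
    push_cast
    exact Finset.sum_le_sum fun v _ => hv v
  rw [← Finset.mul_sum, Fin.sum_univ_eq_sum_range (fun i => e ^ i), geom_sum_eq he1.ne'] at hsum
  have h4 : (e ^ n - 1) / (e - 1) ≤ e ^ n / (e - 1) :=
    div_le_div_of_nonneg_right (by linarith) (by linarith)
  have h5 := hF.trans (hsum.trans (mul_le_mul_of_nonneg_left h4 (by positivity)))
  have h6 : τ * e ^ n * K * e * (e ^ n / (e - 1)) = α / 2 * cbrt3 ^ n := by
    have : e - 1 ≠ 0 := by linarith
    rw [← he2, hτ]
    field_simp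
    ring
  rw [h6] at h5
  have h7 : 0 < α * cbrt3 ^ n := mul_pos hα (pow_pos cbrt3_pos _)
  linarith

/-- The blow-up of a cycle shows that the maximum is of order `3 ^ (n / 3)`. -/
theorem three_pow_le_maxInducedCycles {n : ℕ} (hn : 9 ≤ n) : 3 ^ (n / 3) ≤ maxInducedCycles n := by
  set k := n / 3 with hk
  have hk3 : 3 ≤ k := by omega
  -- Consecutive triples of labels replace the vertices of a cycle of length `k`; the at most two
  -- remaining vertices are isolated.
  let G : SimpleGraph (Fin n) :=
    { Adj := fun u v => ∃ (hu : (u : ℕ) / 3 < k) (hv : (v : ℕ) / 3 < k),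
        (SimpleGraph.cycleGraph k).Adj ⟨_, hu⟩ ⟨_, hv⟩
      symm := ⟨fun u v ⟨hu, hv, h⟩ => ⟨hv, hu, h.symm⟩⟩
      loopless := ⟨fun u ⟨hu, hv, h⟩ => h.ne rfl⟩ }
  have h1 : numInducedCycles G ≤ maxInducedCycles n :=
    le_csSup (Set.finite_range _).bddAbove ⟨G, rfl⟩
  refine le_trans ?_ h1
  have hlt : ∀ (g : Fin k → Fin 3) (i : Fin k), 3 * (i : ℕ) + g i < n := by
    intro g i; have := i.2; have := (g i).2; omega
  let c : (Fin k → Fin 3) → Fin k → Fin n := fun g i => ⟨3 * i + g i, hlt g i⟩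
  have hdiv : ∀ g i, (c g i : ℕ) / 3 = i := by
    intro g i; have := (g i).2; simp only [c]; omega
  have hinj : ∀ g, Function.Injective (c g) := by
    intro g i j h
    have := congrArg (fun z : Fin n => (z : ℕ) / 3) h
    simp only [hdiv] at this
    exact Fin.ext this
  have hadj : ∀ g i j, G.Adj (c g i) (c g j) ↔ (SimpleGraph.cycleGraph k).Adj i j := by
    intro g i j
    simp only [G, hdiv]
    simp
  have hS : ∀ g, IsInducedCycle G (Finset.univ.image (c g)) := by
    intro g
    refine ⟨k, hk3, ⟨⟨Equiv.ofBijective (fun i => ⟨c g i, by simp⟩) ⟨?_, ?_⟩, ?_⟩⟩⟩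
    · intro i j h
      exact hinj g (by simpa using h)
    · rintro ⟨z, hz⟩
      obtain ⟨i, -, rfl⟩ := Finset.mem_image.1 hz
      exact ⟨i, rfl⟩
    · intro i j
      exact hadj g i j
  have hSinj : Function.Injective fun g => Finset.univ.image (c g) := by
    intro g g' h
    funext i
    have h2 : c g i ∈ Finset.univ.image (c g') := by
      have h3 : Finset.univ.image (c g) = Finset.univ.image (c g') := h
      rw [← h3]; simp
    obtain ⟨j, -, hj⟩ := Finset.mem_image.1 h2
    have hji : j = i := by
      have := congrArg (fun z : Fin n => (z : ℕ) / 3) hj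
      simp only [hdiv] at this
      exact Fin.ext this
    subst hji
    have := congrArg Fin.val hj
    simp only [c] at this
    exact Fin.ext (by omega)
  have h2 : (Set.range fun g => Finset.univ.image (c g)) ⊆ {S | IsInducedCycle G S} := by
    rintro _ ⟨g, rfl⟩
    exact hS g
  have h3 := Set.ncard_le_ncard h2 (Set.toFinite _)
  rw [← Set.image_univ, Set.ncard_image_of_injective _ hSinj, Set.ncard_univ] at h3
  simpa [numInducedCycles] using h3

end Cycles

/-! ### Adjacency along a chain, and closing it to a cyclic braid -/

section ClusterChain

open scoped Classical

theorem IsClusterChain.subset {V : Type*} {G : SimpleGraph V} {S W Q : Finset V}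
    {L : List (Finset V)} (h : IsClusterChain G S W Q L) : ∀ B ∈ L, B ⊆ W ∧ B.card = 3 := by
  induction L generalizing W Q with
  | nil => simp
  | cons B L ih =>
    obtain ⟨h1, h2, -, h4⟩ := h
    intro B' hB'
    rcases List.mem_cons.1 hB' with rfl | hB'
    · exact ⟨h1, h2⟩
    · exact ⟨(ih h4 B' hB').1.trans Finset.sdiff_subset, (ih h4 B' hB').2⟩

theorem IsClusterChain.pairwise {V : Type*} {G : SimpleGraph V} {S W Q : Finset V}
    {L : List (Finset V)} (h : IsClusterChain G S W Q L) : L.Pairwise Disjoint := by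
  induction L generalizing W Q with
  | nil => exact List.Pairwise.nil
  | cons B L ih =>
    obtain ⟨-, -, -, h4⟩ := h
    refine List.Pairwise.cons (fun B' hB' => ?_) (ih h4)
    rw [Finset.disjoint_left]
    intro v hv hv'
    exact (Finset.mem_sdiff.1 ((h4.subset B' hB').1 hv')).2 hv

theorem IsClusterChain.mem_or {V : Type*} {G : SimpleGraph V} {S W Q : Finset V}
    {L : List (Finset V)} (h : IsClusterChain G S W Q L) {v : V} (hv : v ∈ W) :
    v ∈ S ∨ ∃ B ∈ L, v ∈ B := by
  induction L generalizing W Q with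
  | nil => exact .inl (h hv)
  | cons B L ih =>
    by_cases hB : v ∈ B
    · exact .inr ⟨B, by simp, hB⟩
    · refine (ih h.2.2.2 (Finset.mem_sdiff.2 ⟨hv, hB⟩)).imp_right ?_
      rintro ⟨B', hB', hv'⟩
      exact ⟨B', List.mem_cons_of_mem _ hB', hv'⟩

theorem IsClusterChain.adj_iff_eq_zero {V : Type*} {G : SimpleGraph V} {S W Q : Finset V}
    {L : List (Finset V)} (h : IsClusterChain G S W Q L) {a b : V} (ha : a ∈ Q) (haS : a ∉ S)
    (hbS : b ∉ S) {j : ℕ} (hj : j < L.length) (hb : b ∈ L[j]) : G.Adj a b ↔ j = 0 := by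
  rcases L with _ | ⟨B, L⟩
  · simp at hj
  rw [h.2.2.1 a ha haS b ((h.subset _ (List.getElem_mem hj)).1 hb) hbS]
  rcases j with _ | j
  · simpa using hb
  · have hj' : j < L.length := by simpa using hj
    have hd := (List.pairwise_cons.1 h.pairwise).1 L[j] (List.getElem_mem _)
    rw [List.getElem_cons_succ] at hb
    simpa using fun hbB => Finset.disjoint_left.1 hd hbB hb

theorem IsClusterChain.adj_iff {V : Type*} {G : SimpleGraph V} {S W Q : Finset V}
    {L : List (Finset V)} (h : IsClusterChain G S W Q L) {a b : V} (haS : a ∉ S)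
    (hbS : b ∉ S) {i j : ℕ} (hij : i < j) (hj : j < L.length) (ha : a ∈ L[i]) (hb : b ∈ L[j]) :
    G.Adj a b ↔ j = i + 1 := by
  induction L generalizing W Q i j with
  | nil => simp at hj
  | cons B L ih =>
    obtain ⟨j, rfl⟩ : ∃ j', j = j' + 1 := ⟨j - 1, by omega⟩
    rcases i with _ | i
    · rw [h.2.2.2.adj_iff_eq_zero (by simpa using ha) haS hbS (by simpa using hj)
        (by simpa using hb)]
      omega
    · rw [ih h.2.2.2 (i := i) (j := j) (by omega) (by simpa using hj) (by simpa using ha)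
        (by simpa using hb)]
      omega

end ClusterChain

/-- A graph whose edges outside `S` respect a cyclic sequence of clusters becomes a cyclic braid
after changing the edges that meet `S`. -/
theorem exists_isCyclicBraid {V : Type*} (F : SimpleGraph V) (S : Finset V) {k : ℕ} (hk : 3 ≤ k)
    (B : Fin k → Finset V) (hne : ∀ i, (B i).Nonempty) (c : V → Fin k)
    (hc : ∀ v i, v ∈ B i ↔ c v = i)
    (hF : ∀ u v, u ∉ S → v ∉ S → c u ≠ c v →
      (F.Adj u v ↔ finRotate k (c u) = c v ∨ finRotate k (c v) = c u)) :
    ∃ F' : SimpleGraph V, (∀ u v, u ∉ S → v ∉ S → (F'.Adj u v ↔ F.Adj u v)) ∧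
      IsCyclicBraid F' B := by
  have hrot : ∀ i : Fin k, finRotate k i ≠ i := by
    obtain ⟨m, rfl⟩ := Nat.exists_eq_add_of_le' hk
    intro i h
    have := congrArg Fin.val h
    rw [coe_finRotate] at this
    split_ifs at this with h'
    · rw [h'] at this; simp at this
    · omega
  let F' : SimpleGraph V :=
    { Adj := fun u v => (u ∉ S ∧ v ∉ S ∧ F.Adj u v) ∨
        ((u ∈ S ∨ v ∈ S) ∧ (finRotate k (c u) = c v ∨ finRotate k (c v) = c u))
      symm := ⟨fun u v h => h.imp (fun h => ⟨h.2.1, h.1, h.2.2.symm⟩)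
        fun h => ⟨h.1.symm, h.2.symm⟩⟩
      loopless := ⟨fun u h => h.elim (fun h => h.2.2.ne rfl)
        fun h => h.2.elim (hrot _) (hrot _)⟩ }
  have hF' : ∀ u v, u ∉ S → v ∉ S → (F'.Adj u v ↔ F.Adj u v) := by
    intro u v hu hv
    simp [F', hu, hv]
  have hadj : ∀ u v, c u ≠ c v →
      (F'.Adj u v ↔ finRotate k (c u) = c v ∨ finRotate k (c v) = c u) := by
    intro u v huv
    by_cases h : u ∈ S ∨ v ∈ S
    · simp only [F', h, true_and, or_iff_right_iff_imp]
      rintro ⟨hu, hv, -⟩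
      exact absurd h (by simp [hu, hv])
    · rw [not_or] at h
      rw [hF' u v h.1 h.2, hF u v h.1 h.2 huv]
  refine ⟨F', hF', hk, hne, fun v => ⟨c v, (hc v _).2 rfl, fun i hi => ((hc v i).1 hi).symm⟩,
    ?_, ?_⟩
  · intro i x hx y hy
    obtain rfl := (hc x i).1 hx
    rw [Set.mem_union, Finset.mem_coe, Finset.mem_coe, hc, hc, Equiv.eq_symm_apply] at hy
    rw [SimpleGraph.mem_neighborSet, hadj x y]
    · exact hy.symm.imp_left Eq.symm
    · rintro e
      rw [← e] at hy
      exact hy.elim (hrot _) fun h => hrot _ h.symm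
  · intro i x hx y hy
    obtain rfl := (hc x i).1 hx
    rw [SimpleGraph.mem_neighborSet] at hy
    simp only [Set.mem_union, Finset.mem_coe, hc, Equiv.eq_symm_apply]
    by_cases e : c x = c y
    · exact .inl (.inr e.symm)
    · rw [hadj x y e] at hy
      exact hy.elim (fun h => .inr h.symm) fun h => .inl (.inl h)

theorem Finset.exists_list_pairwise_disjoint {V : Type*} (R : Finset V) {l : List ℕ}
    (hl : l.sum = R.card) : ∃ L : List (Finset V), L.map Finset.card = l ∧
      L.Pairwise Disjoint ∧ ∀ v, v ∈ R ↔ ∃ B ∈ L, v ∈ B := by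
  classical
  induction l generalizing R with
  | nil =>
    refine ⟨[], rfl, List.Pairwise.nil, fun v => ?_⟩
    rw [Finset.card_eq_zero.1 hl.symm]
    simp
  | cons a l ih =>
    rw [List.sum_cons] at hl
    obtain ⟨B, hB, rfl⟩ := Finset.exists_subset_card_eq (s := R) (n := a) (by omega)
    obtain ⟨L, h1, h2, h3⟩ := ih (R \ B) (by rw [Finset.card_sdiff_of_subset hB]; omega)
    refine ⟨B :: L, by rw [List.map_cons, h1], List.Pairwise.cons (fun B' hB' => ?_) h2,
      fun v => ?_⟩
    · rw [Finset.disjoint_right]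
      intro v hv
      exact (Finset.mem_sdiff.1 ((h3 v).2 ⟨B', hB', hv⟩)).2
    · have := h3 v
      rw [Finset.mem_sdiff] at this
      simp only [List.mem_cons, exists_eq_or_imp, ← this]
      by_cases hv : v ∈ B
      · simp [hv, hB hv]
      · simp [hv]

/-- The number `r` of leftover vertices is congruent to `n` modulo 3, so it splits into threes and
the one exceptional size. Only `r = 1` would fail for `n ≡ 1`, and `r = 0` would leave no cluster to
insert. -/
theorem exists_sizes_eq_extremalClusterSizes {n r t : ℕ} (hr : 2 ≤ r) (hn : r + 3 * t = n) :
    ∃ l : List ℕ, l.sum = r ∧ l ≠ [] ∧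
      ((l ++ List.replicate t 3 : List ℕ) : Multiset ℕ) = extremalClusterSizes n := by
  unfold extremalClusterSizes
  split_ifs with h0 h1
  · refine ⟨List.replicate (r / 3) 3, by simp; omega, by simp; omega, ?_⟩
    rw [List.replicate_append_replicate, Multiset.coe_replicate]
    congr 1; omega
  · refine ⟨4 :: List.replicate (r / 3 - 1) 3, by simp; omega, by simp, ?_⟩
    rw [List.cons_append, List.replicate_append_replicate, ← Multiset.cons_coe,
      Multiset.coe_replicate]
    congr 2; omega
  · refine ⟨2 :: List.replicate (r / 3) 3, by simp; omega, by simp, ?_⟩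
    rw [List.cons_append, List.replicate_append_replicate, ← Multiset.cons_coe,
      Multiset.coe_replicate]
    congr 2; omega

theorem le_card_extremalClusterSizes (n : ℕ) : n / 3 ≤ (extremalClusterSizes n).card := by
  unfold extremalClusterSizes
  split_ifs <;> (simp; try omega)

theorem pos_of_mem_extremalClusterSizes {n a : ℕ} (ha : a ∈ extremalClusterSizes n) : 0 < a := by
  unfold extremalClusterSizes at ha
  split_ifs at ha <;> simp [Multiset.mem_replicate] at ha <;> omega

theorem clusterSizes_get {V : Type*} (L : List (Finset V)) :
    clusterSizes L.get = (L.map Finset.card : Multiset ℕ) := by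
  rw [clusterSizes, Fin.univ_val_map]
  congr 1
  exact (List.map_ofFn (f := L.get) (g := Finset.card)).symm.trans (by rw [List.ofFn_get])

/-- A cluster chain that omits at least two vertices closes up to a cyclic braid with the extremal
cluster sizes. -/
theorem IsClusterChain.exists_isCyclicBraid {n : ℕ} (hn : 9 ≤ n) {F : SimpleGraph (Fin n)}
    {S W Q : Finset (Fin n)} {L : List (Finset (Fin n))} (h : IsClusterChain F S W Q L)
    (hW : Wᶜ ⊆ S) (hW2 : 2 ≤ Wᶜ.card) :
    ∃ F' : SimpleGraph (Fin n), (∀ u v, u ∉ S → v ∉ S → (F'.Adj u v ↔ F.Adj u v)) ∧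
      ∃ (k : ℕ) (B : Fin k → Finset (Fin n)),
        IsCyclicBraid F' B ∧ clusterSizes B = extremalClusterSizes n := by
  set U := (L.toFinset.biUnion id) with hU
  have hmemU : ∀ v, v ∈ U ↔ ∃ B ∈ L, v ∈ B := by intro v; simp [hU]
  have hUW : U ⊆ W := fun v hv => by
    obtain ⟨B, hB, hvB⟩ := (hmemU v).1 hv
    exact (h.subset B hB).1 hvB
  have hRS : Uᶜ ⊆ S := by
    intro v hv
    by_cases hvW : v ∈ W
    · refine (h.mem_or hvW).resolve_right fun h' => ?_
      exact Finset.mem_compl.1 hv ((hmemU v).2 h')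
    · exact hW (Finset.mem_compl.2 hvW)
  have hUc : U.card = 3 * L.length := by
    have hnd : L.Nodup := h.pairwise.imp_of_mem fun {a b} ha _ hab e => by
      subst e
      have := (h.subset a ha).2
      rw [disjoint_self.1 hab] at this
      simp at this
    rw [hU, Finset.card_biUnion, Finset.sum_congr rfl (g := fun _ => 3), Finset.sum_const,
      List.toFinset_card_of_nodup hnd, smul_eq_mul, mul_comm]
    · intro B hB
      exact (h.subset B (List.mem_toFinset.1 hB)).2
    · intro a ha b hb hab
      exact h.pairwise.forall (List.mem_toFinset.1 ha) (List.mem_toFinset.1 hb) hab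
  have hcard := Finset.card_add_card_compl U
  rw [Fintype.card_fin] at hcard
  obtain ⟨l, hl1, hl2, hl3⟩ := exists_sizes_eq_extremalClusterSizes (n := n) (r := Uᶜ.card)
    (t := L.length) (hW2.trans (Finset.card_le_card (Finset.compl_subset_compl.2 hUW))) (by omega)
  obtain ⟨M, hM1, hM2, hM3⟩ := Finset.exists_list_pairwise_disjoint Uᶜ hl1
  -- At least one cluster of exceptional vertices separates the last cluster of the chain from the
  -- first one in the cyclic order.
  have hM0 : 0 < M.length := by
    rw [List.length_pos_iff]
    rintro rfl
    exact hl2 (by simpa using hM1.symm)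
  have hsizes : clusterSizes (M ++ L).get = extremalClusterSizes n := by
    rw [clusterSizes_get, List.map_append, hM1, ← hl3]
    congr 2
    exact List.eq_replicate_iff.2 ⟨by simp, by
      intro b hb
      obtain ⟨B, hB, rfl⟩ := List.mem_map.1 hb
      exact (h.subset B hB).2⟩
  have hlen : 3 ≤ (M ++ L).length := by
    have h1 := le_card_extremalClusterSizes n
    rw [← hsizes, clusterSizes, Multiset.card_map, Finset.card_val, Finset.card_univ,
      Fintype.card_fin] at h1
    omega
  have hne : ∀ i, ((M ++ L).get i).Nonempty := by
    intro i
    rw [← Finset.card_pos]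
    refine pos_of_mem_extremalClusterSizes (n := n) ?_
    rw [← hsizes]
    exact Multiset.mem_map_of_mem _ (Finset.mem_univ i)
  have hpair : (M ++ L).Pairwise Disjoint := by
    refine List.pairwise_append.2 ⟨hM2, h.pairwise, fun A hA B hB => ?_⟩
    rw [Finset.disjoint_left]
    intro v hvA hvB
    exact Finset.mem_compl.1 ((hM3 v).2 ⟨A, hA, hvA⟩) ((hmemU v).2 ⟨B, hB, hvB⟩)
  have hcov : ∀ v, ∃ i, v ∈ (M ++ L).get i := by
    intro v
    have : ∃ B ∈ M ++ L, v ∈ B := by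
      by_cases hv : v ∈ U
      · obtain ⟨B, hB, hvB⟩ := (hmemU v).1 hv
        exact ⟨B, List.mem_append_right _ hB, hvB⟩
      · obtain ⟨B, hB, hvB⟩ := (hM3 v).1 (Finset.mem_compl.2 hv)
        exact ⟨B, List.mem_append_left _ hB, hvB⟩
    obtain ⟨B, hB, hvB⟩ := this
    obtain ⟨i, rfl⟩ := List.get_of_mem hB
    exact ⟨i, hvB⟩
  choose c hc using hcov
  have hc' : ∀ v i, v ∈ (M ++ L).get i ↔ c v = i := by
    intro v i
    refine ⟨fun hv => ?_, fun e => e ▸ hc v⟩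
    by_contra hne
    rcases lt_or_gt_of_ne hne with hlt | hlt
    · exact Finset.disjoint_left.1 (List.pairwise_iff_get.1 hpair _ _ hlt) (hc v) hv
    · exact Finset.disjoint_left.1 (List.pairwise_iff_get.1 hpair _ _ hlt) hv (hc v)
  have hlow : ∀ v, v ∉ S → M.length ≤ c v := by
    intro v hv
    by_contra! hlt
    have h1 := hc v
    rw [List.get_eq_getElem, List.getElem_append_left hlt] at h1
    exact hv (hRS ((hM3 v).2 ⟨_, List.getElem_mem hlt, h1⟩))
  -- The successor of the last index is 0, which lies in the exceptional part `M`. So among the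
  -- chain clusters, cyclic and linear neighbourship agree.
  have hrot : ∀ i j : Fin (M ++ L).length, M.length ≤ i → i < j →
      ((finRotate _ i = j ∨ finRotate _ j = i) ↔ (j : ℕ) = i + 1) := by
    obtain ⟨m, hm⟩ : ∃ m, (M ++ L).length = m + 1 := ⟨(M ++ L).length - 1, by omega⟩
    rw [hm]
    intro i j hi hij
    rw [Fin.ext_iff, Fin.ext_iff, coe_finRotate, coe_finRotate]
    have h1 : i ≠ Fin.last m := (lt_of_lt_of_le hij (Fin.le_last j)).ne
    rw [if_neg h1]
    have := Fin.lt_def.1 hij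
    split_ifs <;> omega
  have hadj : ∀ u v, u ∉ S → v ∉ S → c u < c v → (F.Adj u v ↔ (c v : ℕ) = c u + 1) := by
    intro u v hu hv huv
    have hu1 := hlow u hu
    have hv1 := hlow v hv
    have hu2 := hc u
    have hv2 := hc v
    have hv3 := (c v).2
    have hML : (M ++ L).length = M.length + L.length := List.length_append
    have := Fin.lt_def.1 huv
    rw [List.get_eq_getElem, List.getElem_append_right hu1] at hu2
    rw [List.get_eq_getElem, List.getElem_append_right hv1] at hv2
    rw [h.adj_iff hu hv (i := c u - M.length) (j := c v - M.length) (by omega) (by omega) hu2 hv2]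
    omega
  obtain ⟨F', hF', hbraid⟩ := _root_.exists_isCyclicBraid F S hlen (M ++ L).get hne c hc' (by
    intro u v hu hv huv
    rcases lt_or_gt_of_ne huv with hlt | hlt
    · rw [hrot _ _ (hlow u hu) hlt, hadj u v hu hv hlt]
    · rw [or_comm, hrot _ _ (hlow v hv) hlt, F.adj_comm, hadj v u hv hu hlt])
  exact ⟨F', hF', _, _, hbraid, hsizes⟩

/-! ### The stability theorem -/

theorem cbrt3_pow_le_mul_maxInducedCycles {n : ℕ} (hn : 9 ≤ n) :
    cbrt3 ^ n ≤ 3 * (maxInducedCycles n : ℝ) := by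
  have h1 : ((3 ^ (n / 3) : ℕ) : ℝ) ≤ maxInducedCycles n :=
    Nat.cast_le.2 (three_pow_le_maxInducedCycles hn)
  have h2 : cbrt3 ^ n ≤ cbrt3 ^ (3 * (n / 3 + 1)) :=
    pow_le_pow_right₀ one_lt_cbrt3.le (by omega)
  rw [pow_mul, cbrt3_pow_three, pow_succ] at h2
  push_cast at h1
  linarith

theorem theorem1p4 (α : ℝ) (hα₀ : 0 < α) (hα₁ : α < 1) :
    ∃ C n₀ : ℕ, ∀ n : ℕ, n₀ ≤ n → ∀ F : SimpleGraph (Fin n),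
      α * (maxInducedCycles n : ℝ) ≤ (numInducedCycles F : ℝ) →
        ∃ (S : Finset (Fin n)) (F' : SimpleGraph (Fin n)),
          S.card ≤ C ∧
          (∀ u v : Fin n, u ∉ S → v ∉ S → (F'.Adj u v ↔ F.Adj u v)) ∧
          ∃ (k : ℕ) (B : Fin k → Finset (Fin n)),
            IsCyclicBraid F' B ∧ clusterSizes B = extremalClusterSizes n := by
  classical
  -- The factor 3 absorbs the rounding in `cbrt3 ^ n ≤ 3 * maxInducedCycles n`.
  obtain ⟨ρ, hρ, hpaths⟩ := exists_many_indPaths (α := α / 3) (by linarith)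
  obtain ⟨C, hC⟩ := exists_isClusterChain hρ
  obtain ⟨c₁, hc₁⟩ := pow_unbounded_of_one_lt (1 / ρ) one_lt_cbrt3
  refine ⟨C + c₁, 9, fun n hn F hF => ?_⟩
  have hn' := cbrt3_pow_le_mul_maxInducedCycles hn
  obtain ⟨v, u, w, W, hvu, hvW, huW, hcard⟩ := hpaths n F (by nlinarith)
  have hWn : W.card ≤ n := by simpa using Finset.card_le_univ W
  have hcW := card_indPaths_le (G := F) (w := w) huW
  -- There are at least ρ c ^ n paths and at most c ^ |W|, so `W` misses few vertices and all of
  -- these may be made exceptional.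
  have hWc : Wᶜ.card ≤ c₁ := by
    rw [Finset.card_compl, Fintype.card_fin]
    by_contra! hcon
    have h1 : cbrt3 ^ n = cbrt3 ^ (n - W.card) * cbrt3 ^ W.card := by
      rw [← pow_add, Nat.sub_add_cancel hWn]
    have h2 := pow_le_pow_right₀ one_lt_cbrt3.le hcon.le
    have h3 := hcard.trans hcW
    have h4 := pow_pos cbrt3_pos W.card
    have h5 : 1 < ρ * cbrt3 ^ (n - W.card) := by
      rw [← div_lt_iff₀' hρ]; exact hc₁.trans_le h2
    rw [h1] at h3
    nlinarith
  have hr : ρ ≤ ratio F w W u := by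
    rw [ratio, le_div_iff₀ (pow_pos cbrt3_pos _)]
    refine le_trans (mul_le_mul_of_nonneg_left ?_ hρ.le) hcard
    exact pow_le_pow_right₀ one_lt_cbrt3.le hWn
  obtain ⟨S, hSW, L, hSC, hL⟩ := hC F w W u huW (by convert hr)
  have hS' : IsClusterChain F (S ∪ Wᶜ) W {u} L :=
    hL.mono Finset.subset_union_left subset_rfl fun _ hv _ => hv
  -- The removed cycle vertex `v` and the start `u` both lie outside `W`; these two vertices make
  -- the regrouping of sizes possible.
  obtain ⟨F', hF', hB⟩ := hS'.exists_isCyclicBraid hn Finset.subset_union_right (by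
    have : ({v, u} : Finset (Fin n)) ⊆ Wᶜ := by
      intro z hz
      rw [Finset.mem_insert, Finset.mem_singleton] at hz
      rcases hz with rfl | rfl <;> simpa
    simpa [Finset.card_pair hvu] using Finset.card_le_card this)
  refine ⟨S ∪ Wᶜ, F', ?_, hF', hB⟩
  have := Finset.card_union_le S Wᶜ
  omega
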